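/- **Setting.** Let $\mathcal X$ be a set, $f:\mathbb R^d\times\mathcal X\to\mathbb R$ a loss that is measurable in its first argument, and $\mathcal D=(x_1,\dots,x_n)\in\mathcal X^n$ a dataset. Two datasets in $\mathcal X^n$ are adjacent if they differ in at most one record. A randomized mechanism $\mathcal A$ on $\mathcal X^n$ is $(\epsilon,\delta)$-differentially private (DP) if $\Pr[\mathcal A(\mathcal D)\in s]\le e^{\epsilon}\Pr[\mathcal A(\mathcal D')\in s]+\delta$ for all adjacent $\mathcal D,\mathcal D'$ and all measurable sets $s$ of outputs. **Algorithm (stagewise DP zeroth-order optimizer).** Inputs: a starting point $\theta^0\in\mathbb R^d$, integers $P\ge1$ (number of directions), $1\le m\le n$ (sample size), $S\ge 0$ (number of stages), $T_0\ge 0$, and reals $C>0$ (clipping threshold), $\sigma$ (noise scale), $\lambda>0$, $\eta_0\ge0$, $\beta_0>0$, $k>0$. For $s=1,\dots,S$ put $\beta_s=k\beta_{s-1}$, $T_s=2T_{s-1}$, $\eta_s=\eta_{s-1}/2$, set $\theta_0=\theta^{s-1}$, and for $t=1,\dots,T_s$ do the following with fresh independent randomness: draw a uniformly random $m$-element subset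 $\xi_t=\{x_t^1,\dots,x_t^m\}$ of the $n$ data points and $P$ independent standard Gaussian vectors $v_t^1,\dots,v_t^P\in\mathbb R^d$; for each $p$ and $i$ compute $$g^{i,p}=\frac{1}{2\beta_s}\bigl(f(\theta_{t-1}+\beta_sv_t^p,x_t^i)-f(\theta_{t-1}-\beta_sv_t^p,x_t^i)\bigr),\qquad \hat g^{i,p}=\frac{g^{i,p}}{\max\{1,|g^{i,p}|/C\}};$$ draw independent noises $z_t^p\sim N(0,\sigma^2C^2)$ and set $$\theta_t=\theta_{t-1}-\eta_s\cdot\frac1P\sum_{p=1}^P\frac1m\Bigl(\sum_{i=1}^m\bigl(\hat g^{i,p}+\tfrac1\lambda\|\theta_{t-1}-\theta_0\|\bigr)+z_t^p\Bigr)v_t^p .$$ Set $\theta^s=\theta_{T_s}$. The output is $\theta^S$. Let $T=\sum_{s=1}^ST_s$ be the total number of iterations. **Theorem.** For every $K>0$ there are constants $c_1,c_2>0$, depending only on $K$, such that for all data and parameters as above, all $\delta>0$ and all $\epsilon>0$ with $\epsilon\le K\log(P/\delta)$ and $\epsilon<c_1m^2T/n^2$, the algorithm $\mathcal D\mapsto\theta^S$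 is $(\epsilon,\delta)$-DP whenever $$\sigma^2\ \ge\ \frac{c_2^2\,P^2m^2\,T\log(P/\delta)}{\epsilon^2n^2}.$$ -/

import Mathlib

open MeasureTheory ProbabilityTheory
open scoped ENNReal NNReal

noncomputable section

namespace DPZO

/-- Two datasets of size `n` are adjacent if they differ in at most one record
(Hamming distance at most one). -/
def Adjacent {X : Type*} {n : ℕ} (D D' : Fin n → X) : Prop :=
  ∃ i, ∀ j, j ≠ i → D j = D' j

/-- `(ε, δ)`-differential privacy of a randomized mechanism `A`, given by the law `A D` of its
output on each dataset `D` of size `n`. -/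
def IsDP {X Y : Type*} [MeasurableSpace Y] {n : ℕ} (A : (Fin n → X) → Measure Y)
    (ε δ : ℝ) : Prop :=
  ∀ D D' : Fin n → X, Adjacent D D' → ∀ s : Set Y, MeasurableSet s →
    A D s ≤ ENNReal.ofReal (Real.exp ε) * A D' s + ENNReal.ofReal δ

/-- The parameter space `ℝ^d` with its Euclidean norm. -/
abbrev Param (d : ℕ) : Type := EuclideanSpace ℝ (Fin d)

/-- The inputs of the stagewise algorithm, apart from the loss, the starting point and the data. -/
structure Config where
  /-- number of random directions per iteration -/
  P : ℕ
  /-- number of data points sampled per iteration -/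
  m : ℕ
  /-- number of stages -/
  S : ℕ
  /-- initial iteration number -/
  T₀ : ℕ
  /-- clipping threshold -/
  C : ℝ
  /-- noise scale -/
  σ : ℝ
  /-- regularization parameter `λ` -/
  lam : ℝ
  /-- initial stepsize -/
  η₀ : ℝ
  /-- initial zeroth-order scale parameter -/
  β₀ : ℝ
  /-- growth factor of the zeroth-order scale parameter -/
  k : ℝ

namespace Config

variable (c : Config)

/-- `β_s = k β_{s-1}`. -/
def β : ℕ → ℝ
  | 0 => c.β₀
  | s + 1 => c.k * β s

/-- `T_s = 2 T_{s-1}`. -/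
def T : ℕ → ℕ
  | 0 => c.T₀
  | s + 1 => 2 * T s

/-- `η_s = η_{s-1} / 2`. -/
def η : ℕ → ℝ
  | 0 => c.η₀
  | s + 1 => η s / 2

/-- The total number `T_1 + ⋯ + T_S` of iterations over all stages. -/
def totalSteps : ℕ := ∑ s ∈ Finset.Icc 1 c.S, c.T s

end Config

/-- Clipping of a scalar to `[-C, C]`: `g / max {1, |g| / C}`. -/
def clip (C g : ℝ) : ℝ := g / max 1 (|g| / C)

/-- The scalar two-point finite difference
`(f(θ + βv, x) - f(θ - βv, x)) / (2β)`. -/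
def finiteDiff {X : Type*} {d : ℕ} (f : Param d → X → ℝ) (β : ℝ) (θ v : Param d) (x : X) : ℝ :=
  1 / (2 * β) * (f (θ + β • v) x - f (θ - β • v) x)

section Algorithm

variable {X : Type*} {d n : ℕ} (c : Config) (f : Param d → X → ℝ) (D : Fin n → X)

/-- One update of the inner loop in stage `s`, as a function of the reference point `θ₀` of the
stage, the current point `θ`, the index set `B` of the minibatch, the directions `v p` and the
noises `z p`. -/
def update (s : ℕ) (θ₀ θ : Param d) (B : Finset (Fin n)) (v : Fin c.P → Param d)
    (z : Fin c.P → ℝ) : Param d :=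
  θ - c.η s • ((1 / (c.P : ℝ)) • ∑ p,
    (1 / (c.m : ℝ) *
      ((∑ i ∈ B, (clip c.C (finiteDiff f (c.β s) θ (v p) (D i)) + 1 / c.lam * ‖θ - θ₀‖))
        + z p)) • v p)

/-- The law of one iteration of the inner loop: the minibatch is uniform among the `m`-element
subsets of the `n` data points, the `P` directions are standard Gaussian vectors, the `P` scalar
noises have law `N(0, σ²C²)`, and all of them are independent. -/
def stepLaw (s : ℕ) (θ₀ θ : Param d) : Measure (Param d) :=
  ((n.choose c.m : ℝ≥0∞)⁻¹) • ∑ B ∈ Finset.powersetCard c.m (Finset.univ : Finset (Fin n)),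
    ((Measure.pi fun _ : Fin c.P => stdGaussian (Param d)).prod
      (Measure.pi fun _ : Fin c.P => gaussianReal 0 (Real.toNNReal (c.σ ^ 2 * c.C ^ 2)))).map
        fun w => update c f D s θ₀ θ B w.1 w.2

/-- The law of the inner iterate after `t` iterations of stage `s`, started at `θ₀`. -/
def innerLaw (s : ℕ) (θ₀ : Param d) : ℕ → Measure (Param d)
  | 0 => Measure.dirac θ₀
  | t + 1 => (innerLaw s θ₀ t).bind (stepLaw c f D s θ₀)

/-- The law of the point returned by the first `s` stages, started at `θinit`: stage `s + 1` runs
`T_{s+1}` iterations of the inner loop from the point returned by stage `s`. -/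
def stageLaw (θinit : Param d) : ℕ → Measure (Param d)
  | 0 => Measure.dirac θinit
  | s + 1 => (stageLaw θinit s).bind fun θ₀ => innerLaw c f D (s + 1) θ₀ (c.T (s + 1))

/-- The law of the output of the stagewise private zeroth-order algorithm on the dataset `D`. -/
def stagewiseDPZO (θinit : Param d) : Measure (Param d) := stageLaw c f D θinit c.S

end Algorithm

end DPZO

end

namespace DPZO

/-! ### Scalar inequalities for powers -/

/-! Privacy is tracked by a Rényi divergence of large order α, written dually: `DualRenyi r A μ ν`
bounds ∫ g dμ by A (∫ g^r dν)^(1/r) for all g ≥ 0, which needs no densities. In this form adaptive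
composition is a substitution and joint convexity is Jensen, so a bound for one iteration, uniform
in the current and reference points, is simply raised to the power T.

For one iteration, fix the directions. The update is then a function of P noisy scalars, and
exchanging one record in the batch moves each noiseless scalar by at most 2C. This is a Gaussian
mechanism with squared sensitivity over variance at most M = 4P/σ², whatever d is. Sampling m of n
records is a mixture, over exchanges of the differing record with one outside the batch, of laws
(1-q) N(a) + q N(b) with q = m/n, where a is common to both datasets. Relative to N(a) such a law
has density u = 1 - q + qR, with R log-normal of mean 1. Passing from one mixture to N(a) and on to
the other takes Hölder's inequality twice, with moments of u of orders α and -(α-1)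
(`lintegral_mix_gaussian_le`).

The analytic core is `HasLogNormalMoments.integral_mix_rpow_le`: as E R = 1, the linear term in the
expansion of u^β integrates to zero, leaving E u^β ≤ exp(O(β²q²M)) while |β|M ≤ 1/4. An iteration
thus costs O(αq²M). Taking α of order log(P/δ)/ε balances Tαq²M against log(P/δ)/α (`exists_order`),
and ε < Tq² keeps αM small. -/

lemma one_add_mul_sub_le_rpow {u β : ℝ} (hu : 0 < u) (hβ : 1 ≤ β ∨ β ≤ 0) :
    1 + β * (u - 1) ≤ u ^ β := by
  rcases hβ with hβ | hβ
  · have := one_add_mul_self_le_rpow_one_add (s := u - 1) (by linarith) hβ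
    simpa using this
  · rw [Real.rpow_def_of_pos hu]
    have h1 := Real.add_one_le_exp (Real.log u * β)
    have h2 := Real.log_le_sub_one_of_pos hu
    nlinarith

/-- The tangent inequality of the convex function `u ↦ u ^ β` at `u`, evaluated at `1`. -/
lemma rpow_sub_one_le {u β : ℝ} (hu : 0 < u) (hβ : 1 ≤ β ∨ β ≤ 0) :
    u ^ β - 1 ≤ β * (u - 1) * u ^ (β - 1) := by
  have h := one_add_mul_sub_le_rpow (inv_pos.2 hu) hβ
  have hp : 0 < u ^ β := Real.rpow_pos_of_pos hu _
  rw [Real.inv_rpow hu.le] at h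
  have h2 := mul_le_mul_of_nonneg_left h hp.le
  rw [mul_inv_cancel₀ hp.ne'] at h2
  rw [Real.rpow_sub_one hu.ne']
  have h3 : u ^ β * (1 + β * (u⁻¹ - 1)) = u ^ β - β * (u - 1) * (u ^ β / u) := by
    field_simp
    ring
  linarith

/-- Second order upper bound for powers around `1`. -/
lemma rpow_le_second_order {u β : ℝ} (hu : 0 < u) (hβ : 2 ≤ β ∨ β ≤ 0) :
    u ^ β ≤ 1 + β * (u - 1) + β * (β - 1) * (u - 1) ^ 2 * (1 + u ^ (β - 2)) := by
  have hβ' : 1 ≤ β ∨ β ≤ 0 := hβ.imp (by intro h; linarith) id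
  have hβ'' : 1 ≤ β - 1 ∨ β - 1 ≤ 0 := hβ.imp (by intro h; linarith) (by intro h; linarith)
  have hb : 0 ≤ β * (β - 1) := by rcases hβ with h | h <;> nlinarith
  have h1 := rpow_sub_one_le hu hβ'
  have h2 := rpow_sub_one_le hu hβ''
  have h3 := one_add_mul_sub_le_rpow hu hβ''
  have e : β - 1 - 1 = β - 2 := by ring
  rw [e] at h2
  have hp : 0 < u ^ (β - 2) := Real.rpow_pos_of_pos hu _
  have hsq : 0 ≤ β * (β - 1) * (u - 1) ^ 2 := mul_nonneg hb (sq_nonneg _)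
  have hsq' := mul_nonneg hsq hp.le
  -- The tangent inequality `h1` leaves this remainder. The tangents of u^(β-1) at u and at 1 bound
  -- its increment from above and from below; the sign of β(u-1) decides which is needed, and the
  -- factor 1 + u^(β-2) covers both.
  have key : β * (u - 1) * (u ^ (β - 1) - 1)
      ≤ β * (β - 1) * (u - 1) ^ 2 * (1 + u ^ (β - 2)) := by
    rcases le_total 0 (β * (u - 1)) with hs | hs
    · have := mul_le_mul_of_nonneg_left h2 hs
      nlinarith
    · have := mul_le_mul_of_nonpos_left h3 hs
      nlinarith
  nlinarith

lemma mix_pos {q R : ℝ} (hq0 : 0 ≤ q) (hq1 : q ≤ 1) (hR : 0 < R) : 0 < 1 - q + q * R := by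
  rcases hq0.eq_or_lt with rfl | h
  · simp
  · have := mul_pos h hR
    linarith

/-- One summand per regime: R ≤ 1; 1 ≤ R ≤ e, where R - 1 ≤ 2 log R; and R ≥ e, where R^t ≥ e^t. In
the bulk the exponent carries a factor q, which later becomes q²; only the tail sees the full
exponent, at the price e^(-t). -/
lemma mix_rpow_le_of_nonneg {q R β t : ℝ} (hq0 : 0 ≤ q) (hq1 : q ≤ 1) (hR : 0 < R)
    (hβ : 0 ≤ β) (ht : 0 ≤ t) :
    (1 - q + q * R) ^ β ≤ 1 + R ^ (2 * β * q) + Real.exp (-t) * R ^ (β + t) := by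
  have hu := mix_pos hq0 hq1 hR
  have p1 : 0 < R ^ (2 * β * q) := Real.rpow_pos_of_pos hR _
  have p2 : 0 < Real.exp (-t) * R ^ (β + t) := mul_pos (Real.exp_pos _) (Real.rpow_pos_of_pos hR _)
  rcases le_total R 1 with h | h
  · have : (1 - q + q * R) ^ β ≤ 1 := Real.rpow_le_one hu.le (by nlinarith) hβ
    linarith
  rcases le_total (Real.log R) 1 with h' | h'
  · have hl : 0 ≤ Real.log R := Real.log_nonneg h
    have h1 := Real.abs_exp_sub_one_le (x := Real.log R) (by rw [abs_of_nonneg hl]; exact h')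
    rw [Real.exp_log hR, abs_of_nonneg hl, abs_of_nonneg (by linarith)] at h1
    have h2 : 1 - q + q * R ≤ Real.exp (q * (R - 1)) := by
      have := Real.add_one_le_exp (q * (R - 1))
      linarith
    have h3 : (1 - q + q * R) ^ β ≤ R ^ (2 * β * q) := by
      calc (1 - q + q * R) ^ β ≤ Real.exp (q * (R - 1)) ^ β := by gcongr
        _ = Real.exp (q * (R - 1) * β) := (Real.exp_mul _ _).symm
        _ ≤ Real.exp (Real.log R * (2 * β * q)) := by
            apply Real.exp_le_exp.2
            have := mul_le_mul_of_nonneg_left h1 (mul_nonneg hq0 hβ)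
            nlinarith
        _ = _ := by rw [Real.rpow_def_of_pos hR]
    linarith
  · have h1 : (1 - q + q * R) ^ β ≤ R ^ β := by
      apply Real.rpow_le_rpow hu.le _ hβ
      nlinarith
    have h2 : R ^ β ≤ Real.exp (-t) * R ^ (β + t) := by
      rw [Real.rpow_def_of_pos hR, Real.rpow_def_of_pos hR, ← Real.exp_add]
      apply Real.exp_le_exp.2
      nlinarith
    linarith

/-- Weighted AM-GM gives R^q ≤ 1 - q + qR, so no tail term is needed for negative exponents. -/
lemma mix_rpow_le_of_nonpos {q R β : ℝ} (hq0 : 0 ≤ q) (hq1 : q ≤ 1) (hR : 0 < R)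
    (hβ : β ≤ 0) : (1 - q + q * R) ^ β ≤ R ^ (β * q) := by
  have h := rpow_one_add_le_one_add_mul_self (s := R - 1) (by linarith) hq0 hq1
  have h1 : R ^ q ≤ 1 - q + q * R := by
    have e : 1 + (R - 1) = R := by ring
    rw [e] at h; linarith
  calc (1 - q + q * R) ^ β ≤ (R ^ q) ^ β :=
        Real.rpow_le_rpow_of_nonpos (Real.rpow_pos_of_pos hR _) h1 hβ
    _ = R ^ (β * q) := by rw [← Real.rpow_mul hR.le, mul_comm]

/-- Jensen for a two-point law, from the tangent inequality at 1/u and R/u, whose weighted mean is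
1. It gains nothing from small q; it serves integrability and the case q ≥ 1/2. -/
lemma mix_rpow_le_convex {q R β : ℝ} (hq0 : 0 ≤ q) (hq1 : q ≤ 1) (hR : 0 < R)
    (hβ : 1 ≤ β ∨ β ≤ 0) : (1 - q + q * R) ^ β ≤ 1 - q + q * R ^ β := by
  have hu := mix_pos hq0 hq1 hR
  have hp : 0 < (1 - q + q * R) ^ β := Real.rpow_pos_of_pos hu _
  have h1 := one_add_mul_sub_le_rpow (inv_pos.2 hu) hβ
  have h2 := one_add_mul_sub_le_rpow (div_pos hR hu) hβ
  rw [Real.inv_rpow hu.le] at h1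
  rw [Real.div_rpow hR.le hu.le] at h2
  set u := 1 - q + q * R with hudef
  have h3 := mul_le_mul_of_nonneg_left h1 (sub_nonneg.2 hq1)
  have h4 := mul_le_mul_of_nonneg_left h2 hq0
  have h5 : (1 - q) * (1 + β * (u⁻¹ - 1)) + q * (1 + β * (R / u - 1)) = 1 := by
    field_simp
    rw [hudef]; ring
  have h6 : 1 ≤ (1 - q + q * R ^ β) / u ^ β := by
    have : (1 - q + q * R ^ β) / u ^ β = (1 - q) * (u ^ β)⁻¹ + q * (R ^ β / u ^ β) := by
      field_simp
    linarith
  rwa [one_le_div hp] at h6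

/-! ### Moments of mixtures of log-normal densities -/

/-- `R` is a positive function all of whose real moments under `γ` are those of
`exp (N(-κ/2, κ))`. -/
structure HasLogNormalMoments {Ω : Type*} [MeasurableSpace Ω] (γ : Measure Ω) (R : Ω → ℝ)
    (κ : ℝ) : Prop where
  measurable : Measurable R
  pos : ∀ ω, 0 < R ω
  integrable : ∀ t : ℝ, Integrable (fun ω => R ω ^ t) γ
  integral_eq : ∀ t : ℝ, ∫ ω, R ω ^ t ∂γ = Real.exp (t * (t - 1) * κ / 2)

namespace HasLogNormalMoments

variable {Ω : Type*} [MeasurableSpace Ω] {γ : Measure Ω} {R : Ω → ℝ} {κ : ℝ}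

lemma sq_mul_rpow_eq (h : HasLogNormalMoments γ R κ) (a : ℝ) (ω : Ω) :
    (R ω - 1) ^ 2 * R ω ^ a = R ω ^ (a + 2) - 2 * R ω ^ (a + 1) + R ω ^ a := by
  rw [Real.rpow_add (h.pos ω), Real.rpow_add (h.pos ω), Real.rpow_one, Real.rpow_two]
  ring

lemma integrable_sq_mul_rpow (h : HasLogNormalMoments γ R κ) (a : ℝ) :
    Integrable (fun ω => (R ω - 1) ^ 2 * R ω ^ a) γ := by
  simp_rw [h.sq_mul_rpow_eq]
  exact ((h.integrable _).sub ((h.integrable _).const_mul 2)).add (h.integrable _)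

/-- Tilting by R^a keeps R log-normal, now with mean exp(aκ); the bracket is squared bias plus
variance under the tilted law. -/
lemma integral_sq_mul_rpow (h : HasLogNormalMoments γ R κ) (a : ℝ) :
    ∫ ω, (R ω - 1) ^ 2 * R ω ^ a ∂γ = Real.exp (a * (a - 1) * κ / 2) *
      ((Real.exp (a * κ) - 1) ^ 2 + Real.exp (a * κ) ^ 2 * (Real.exp κ - 1)) := by
  simp_rw [h.sq_mul_rpow_eq]
  have hi : Integrable (fun ω => R ω ^ (a + 2) - 2 * R ω ^ (a + 1)) γ :=
    (h.integrable _).sub ((h.integrable _).const_mul 2)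
  rw [integral_add hi (h.integrable _),
    integral_sub (h.integrable _) ((h.integrable _).const_mul 2), integral_const_mul,
    h.integral_eq, h.integral_eq, h.integral_eq]
  have e1 : (a + 2) * (a + 2 - 1) * κ / 2 = a * (a - 1) * κ / 2 + (a * κ + a * κ + κ) := by ring
  have e2 : (a + 1) * (a + 1 - 1) * κ / 2 = a * (a - 1) * κ / 2 + a * κ := by ring
  rw [e1, e2]
  simp only [Real.exp_add]
  ring

lemma integral_sq_mul_rpow_le (h : HasLogNormalMoments γ R κ) {a M : ℝ} (hκ : 0 ≤ κ)
    (hκM : κ ≤ M) (hM : M ≤ 1 / 8) (ha : |a| * M ≤ 1 / 2) :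
    ∫ ω, (R ω - 1) ^ 2 * R ω ^ a ∂γ ≤ 8 * M * (1 + a ^ 2 * M) * Real.exp (a ^ 2 * M / 2) := by
  have hM0 : 0 ≤ M := hκ.trans hκM
  have haκ : |a * κ| ≤ |a| * M := by
    rw [abs_mul, abs_of_nonneg hκ]; gcongr
  have haκ' := abs_le.1 (haκ.trans ha)
  rw [h.integral_sq_mul_rpow]
  have h1 : Real.exp (a * (a - 1) * κ / 2) ≤ 4 / 3 * Real.exp (a ^ 2 * M / 2) := by
    have : Real.exp (1 / 4) ≤ 4 / 3 := by
      have := Real.exp_bound_div_one_sub_of_interval (x := 1 / 4) (by norm_num) (by norm_num)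
      norm_num at this ⊢; linarith
    calc Real.exp (a * (a - 1) * κ / 2) ≤ Real.exp (1 / 4 + a ^ 2 * M / 2) := by
          apply Real.exp_le_exp.2
          have : a ^ 2 * κ ≤ a ^ 2 * M := by gcongr
          nlinarith [haκ'.1]
      _ ≤ _ := by rw [Real.exp_add]; gcongr
  have h2 : (Real.exp (a * κ) - 1) ^ 2 ≤ 4 * a ^ 2 * M ^ 2 := by
    have := Real.abs_exp_sub_one_le (x := a * κ) (by linarith [haκ.trans ha])
    have h3 : |Real.exp (a * κ) - 1| ≤ 2 * (|a| * M) := by linarith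
    calc (Real.exp (a * κ) - 1) ^ 2 = |Real.exp (a * κ) - 1| ^ 2 := (sq_abs _).symm
      _ ≤ (2 * (|a| * M)) ^ 2 := by gcongr
      _ = _ := by rw [mul_pow, mul_pow, sq_abs]; ring
  have h3 : Real.exp (a * κ) ^ 2 ≤ 2.7182818286 := by
    rw [← Real.exp_nat_mul]
    refine le_trans (Real.exp_le_exp.2 ?_) Real.exp_one_lt_d9.le
    push_cast; linarith [haκ'.2]
  have h4 : Real.exp κ - 1 ≤ 2 * M := by
    have := Real.abs_exp_sub_one_le (x := κ) (by rw [abs_of_nonneg hκ]; linarith)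
    rw [abs_of_nonneg hκ] at this
    linarith [le_abs_self (Real.exp κ - 1)]
  have h4' : 0 ≤ Real.exp κ - 1 := by linarith [Real.add_one_le_exp κ]
  calc _ ≤ 4 / 3 * Real.exp (a ^ 2 * M / 2) * (4 * a ^ 2 * M ^ 2 + 2.7182818286 * (2 * M)) := by
        gcongr
    _ ≤ 4 / 3 * Real.exp (a ^ 2 * M / 2) * (6 * M * (1 + a ^ 2 * M)) := by
        gcongr
        nlinarith [mul_nonneg (sq_nonneg a) (sq_nonneg M)]
    _ = _ := by ring

lemma integral_sq_mul_rpow_le_exp (h : HasLogNormalMoments γ R κ) {a M : ℝ} (hκ : 0 ≤ κ)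
    (hκM : κ ≤ M) (hM : M ≤ 1 / 8) (ha : |a| * M ≤ 1 / 2) :
    ∫ ω, (R ω - 1) ^ 2 * R ω ^ a ∂γ ≤ 8 * M * Real.exp (3 / 2 * (a ^ 2 * M)) := by
  refine (h.integral_sq_mul_rpow_le hκ hκM hM ha).trans ?_
  have : 3 / 2 * (a ^ 2 * M) = a ^ 2 * M + a ^ 2 * M / 2 := by ring
  rw [this, Real.exp_add, mul_assoc (8 * M)]
  have h1 := Real.add_one_le_exp (a ^ 2 * M)
  have hM0 : 0 ≤ M := hκ.trans hκM
  gcongr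
  linarith

/-- The part of the moment coming from the upper tail of `R` is of the order of `M`. -/
lemma exp_neg_mul_integral_sq_mul_rpow_le (h : HasLogNormalMoments γ R κ) {β M : ℝ} (hκ : 0 ≤ κ)
    (hκM : κ ≤ M) (hM0 : 0 < M) (hM : M ≤ 1 / 8) (hβ0 : 0 ≤ β) (hβ : β * M ≤ 1 / 4) :
    Real.exp (-(1 / (4 * M))) * ∫ ω, (R ω - 1) ^ 2 * R ω ^ (β + 1 / (4 * M)) ∂γ ≤ 16 * M := by
  set a := β + 1 / (4 * M) with ha
  have hat : 1 / (4 * M) * M = 1 / 4 := by field_simp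
  have ha0 : 0 ≤ a := by positivity
  have haM : a * M ≤ 1 / 2 := by rw [ha, add_mul, hat]; linarith
  have h1 := h.integral_sq_mul_rpow_le (a := a) hκ hκM hM (by rwa [abs_of_nonneg ha0])
  -- Since aM ≤ 1/2, a²M ≤ 1/(4M) = 2y. The polynomial factor and the exponential then grow at most
  -- like 2e^y and e^y, which the prefactor e^(-2y) cancels exactly.
  set y := 1 / (8 * M) with hy
  have hy0 : 0 ≤ y := by positivity
  have hyM : y * M = 1 / 8 := by rw [hy]; field_simp
  have h4 : 1 / (4 * M) = 2 * y := by rw [hy]; field_simp; norm_num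
  have h2 : a ^ 2 * M ≤ 2 * y := by
    have : a ^ 2 * M * M ≤ 2 * y * M := by nlinarith [mul_nonneg ha0 hM0.le]
    exact le_of_mul_le_mul_right this hM0
  have h3 : (1 + 2 * y) ≤ 2 * Real.exp y := by linarith [Real.add_one_le_exp y]
  rw [h4]
  calc _ ≤ Real.exp (-(2 * y)) * (8 * M * (1 + a ^ 2 * M) * Real.exp (a ^ 2 * M / 2)) := by gcongr
    _ ≤ Real.exp (-(2 * y)) * (8 * M * (2 * Real.exp y) * Real.exp y) := by
        gcongr <;> linarith
    _ = 16 * M * (Real.exp (-(2 * y)) * (Real.exp y * Real.exp y)) := by ring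
    _ = 16 * M := by
        rw [← Real.exp_add, ← Real.exp_add]; ring_nf; simp

lemma mix_measurable (h : HasLogNormalMoments γ R κ) (q β : ℝ) :
    Measurable (fun ω => (1 - q + q * R ω) ^ β) := by
  have := h.measurable
  fun_prop

/-- Controls the second-order remainder. For β ≥ 0 the three regimes contribute 8M, 8M exp(6β²q²M)
and, with t = 1/(4M), 16M for the tail. -/
lemma integrable_sq_mul_mix_rpow_le (h : HasLogNormalMoments γ R κ) {q β M : ℝ} (hq0 : 0 ≤ q)
    (hq1 : q ≤ 1 / 2) (hκ : 0 ≤ κ) (hκM : κ ≤ M) (hM0 : 0 < M) (hM : M ≤ 1 / 8)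
    (hβM : |β| * M ≤ 1 / 4) :
    Integrable (fun ω => (R ω - 1) ^ 2 * (1 - q + q * R ω) ^ β) γ ∧
    ∫ ω, (R ω - 1) ^ 2 * (1 - q + q * R ω) ^ β ∂γ ≤ 32 * M * Real.exp (6 * (β ^ 2 * q ^ 2 * M)) := by
  have hq1' : q ≤ 1 := by linarith
  have hmeas : AEStronglyMeasurable (fun ω => (R ω - 1) ^ 2 * (1 - q + q * R ω) ^ β) γ :=
    (((h.measurable.sub_const 1).pow_const 2).mul (h.mix_measurable q β)).aestronglyMeasurable
  have hz : 0 ≤ β ^ 2 * q ^ 2 * M := by positivity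
  have hnn : ∀ ω, 0 ≤ (R ω - 1) ^ 2 * (1 - q + q * R ω) ^ β := fun ω =>
    mul_nonneg (sq_nonneg _) (Real.rpow_pos_of_pos (mix_pos hq0 hq1' (h.pos ω)) _).le
  rcases le_total 0 β with hβ | hβ
  · rw [abs_of_nonneg hβ] at hβM
    set t := 1 / (4 * M) with ht
    have ht0 : 0 ≤ t := by positivity
    have hle : ∀ ω, (R ω - 1) ^ 2 * (1 - q + q * R ω) ^ β ≤ (R ω - 1) ^ 2 * R ω ^ (0 : ℝ) +
        (R ω - 1) ^ 2 * R ω ^ (2 * β * q) +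
        Real.exp (-t) * ((R ω - 1) ^ 2 * R ω ^ (β + t)) := fun ω => by
      have := mul_le_mul_of_nonneg_left
        (mix_rpow_le_of_nonneg hq0 hq1' (h.pos ω) hβ ht0) (sq_nonneg (R ω - 1))
      rw [Real.rpow_zero]
      linarith
    have hi0 := h.integrable_sq_mul_rpow 0
    have hi1 := h.integrable_sq_mul_rpow (2 * β * q)
    have hi2 := (h.integrable_sq_mul_rpow (β + t)).const_mul (Real.exp (-t))
    have hint : Integrable (fun ω => (R ω - 1) ^ 2 * (1 - q + q * R ω) ^ β) γ :=
      Integrable.mono' ((hi0.add hi1).add hi2) hmeas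
        (ae_of_all _ fun ω => by rw [Real.norm_of_nonneg (hnn ω)]; exact hle ω)
    refine ⟨hint, ?_⟩
    have hi01 : Integrable (fun ω => (R ω - 1) ^ 2 * R ω ^ (0 : ℝ) +
        (R ω - 1) ^ 2 * R ω ^ (2 * β * q)) γ := hi0.add hi1
    have h0 := integral_mono hint (hi01.add hi2) hle
    simp only [Pi.add_apply] at h0
    rw [integral_add hi01 hi2, integral_const_mul, integral_add hi0 hi1] at h0
    have b0 := h.integral_sq_mul_rpow_le_exp (a := 0) hκ hκM hM (by norm_num)
    have b1 := h.integral_sq_mul_rpow_le_exp (a := 2 * β * q) hκ hκM hM (by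
      rw [abs_of_nonneg (by positivity)]
      nlinarith [mul_nonneg hβ hM0.le])
    have b2 := h.exp_neg_mul_integral_sq_mul_rpow_le hκ hκM hM0 hM hβ hβM
    have e1 : 3 / 2 * ((2 * β * q) ^ 2 * M) = 6 * (β ^ 2 * q ^ 2 * M) := by ring
    rw [e1] at b1
    have e0 : (1 : ℝ) ≤ Real.exp (6 * (β ^ 2 * q ^ 2 * M)) := Real.one_le_exp (by positivity)
    norm_num at b0
    have b0' : ∫ ω, (R ω - 1) ^ 2 * R ω ^ (0 : ℝ) ∂γ ≤ 8 * M := by simpa using b0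
    nlinarith
  · rw [abs_of_nonpos hβ] at hβM
    have hle : ∀ ω, (R ω - 1) ^ 2 * (1 - q + q * R ω) ^ β ≤ (R ω - 1) ^ 2 * R ω ^ (β * q) :=
      fun ω => mul_le_mul_of_nonneg_left
        (mix_rpow_le_of_nonpos hq0 hq1' (h.pos ω) hβ) (sq_nonneg _)
    have hi1 := h.integrable_sq_mul_rpow (β * q)
    have hint : Integrable (fun ω => (R ω - 1) ^ 2 * (1 - q + q * R ω) ^ β) γ :=
      Integrable.mono' hi1 hmeas
        (ae_of_all _ fun ω => by rw [Real.norm_of_nonneg (hnn ω)]; exact hle ω)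
    refine ⟨hint, (integral_mono hint hi1 hle).trans ?_⟩
    have b1 := h.integral_sq_mul_rpow_le_exp (a := β * q) hκ hκM hM (by
      rw [abs_of_nonpos (mul_nonpos_of_nonpos_of_nonneg hβ hq0)]
      nlinarith [mul_nonneg (neg_nonneg.2 hβ) hM0.le])
    refine b1.trans ?_
    have : 3 / 2 * ((β * q) ^ 2 * M) ≤ 6 * (β ^ 2 * q ^ 2 * M) := by
      rw [mul_pow]; linarith
    gcongr
    norm_num

variable [IsProbabilityMeasure γ]

lemma integrable_mix_rpow (h : HasLogNormalMoments γ R κ) {q β : ℝ} (hq0 : 0 ≤ q) (hq1 : q ≤ 1)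
    (hβ : 1 ≤ β ∨ β ≤ 0) : Integrable (fun ω => (1 - q + q * R ω) ^ β) γ := by
  refine Integrable.mono' (((integrable_const (1 - q)).add ((h.integrable β).const_mul q)))
    (h.mix_measurable q β).aestronglyMeasurable (ae_of_all _ fun ω => ?_)
  rw [Real.norm_of_nonneg (Real.rpow_pos_of_pos (mix_pos hq0 hq1 (h.pos ω)) _).le]
  exact mix_rpow_le_convex hq0 hq1 (h.pos ω) hβ

lemma integral_mix_rpow_le_convex (h : HasLogNormalMoments γ R κ) {q β : ℝ} (hq0 : 0 ≤ q)
    (hq1 : q ≤ 1) (hκ : 0 ≤ κ) (hβ : 1 ≤ β ∨ β ≤ 0) :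
    ∫ ω, (1 - q + q * R ω) ^ β ∂γ ≤ Real.exp (β * (β - 1) * κ / 2) := by
  have h0 : ∫ ω, (1 - q + q * R ω) ^ β ∂γ ≤ ∫ ω, (1 - q + q * R ω ^ β) ∂γ :=
    integral_mono (h.integrable_mix_rpow hq0 hq1 hβ)
      ((integrable_const (1 - q)).add ((h.integrable β).const_mul q))
      fun ω => mix_rpow_le_convex hq0 hq1 (h.pos ω) hβ
  rw [integral_add (integrable_const _) ((h.integrable β).const_mul q), integral_const_mul,
    h.integral_eq] at h0
  simp only [integral_const, probReal_univ, one_smul] at h0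
  have h1 : 1 ≤ Real.exp (β * (β - 1) * κ / 2) := by
    apply Real.one_le_exp
    have : 0 ≤ β * (β - 1) := by rcases hβ with hβ | hβ <;> nlinarith
    positivity
  nlinarith

/-- Moments of a mixture density `1 - q + q R`: privacy amplification by subsampling. -/
theorem integral_mix_rpow_le (h : HasLogNormalMoments γ R κ) {q β M : ℝ} (hq0 : 0 ≤ q)
    (hq1 : q ≤ 1) (hκ : 0 ≤ κ) (hκM : κ ≤ M) (hM0 : 0 < M) (hβ : 2 ≤ β ∨ β ≤ -2)
    (hβM : |β| * M ≤ 1 / 4) :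
    ∫ ω, (1 - q + q * R ω) ^ β ∂γ ≤ Real.exp (576 * (β ^ 2 * q ^ 2 * M)) := by
  have hβ1 : 1 ≤ β ∨ β ≤ 0 := hβ.imp (by intro h; linarith) (by intro h; linarith)
  have hβ2 : 2 ≤ β ∨ β ≤ 0 := hβ.imp id (by intro h; linarith)
  have hb0 : 0 ≤ β * (β - 1) := by rcases hβ with h | h <;> nlinarith
  have hb : β * (β - 1) ≤ 2 * β ^ 2 := by rcases hβ with h | h <;> nlinarith
  rcases le_total (1 / 2) q with hq | hq
  -- For q ≥ 1/2 there is nothing to amplify: q² ≥ 1/4 is absorbed in the constant.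
  · refine (h.integral_mix_rpow_le_convex hq0 hq1 hκ hβ1).trans (Real.exp_le_exp.2 ?_)
    have h1 : β * (β - 1) * κ ≤ 2 * β ^ 2 * M := by gcongr
    have h2 : (1 / 4 : ℝ) ≤ q ^ 2 := by nlinarith
    have h3 : β ^ 2 * (1 / 4) * M ≤ β ^ 2 * q ^ 2 * M := by gcongr
    linarith [mul_nonneg (sq_nonneg β) hM0.le]
  · have habs : 2 ≤ |β| := by
      rcases hβ with h | h
      · exact h.trans (le_abs_self _)
      · have := neg_le_abs β; linarith
    have hM : M ≤ 1 / 8 := by nlinarith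
    obtain ⟨hint, hle⟩ := h.integrable_sq_mul_mix_rpow_le hq0 hq hκ hκM hM0 hM hβM
    set z := β ^ 2 * q ^ 2 * M with hz
    have hz0 : 0 ≤ z := by positivity
    have hi0 := h.integrable_sq_mul_rpow 0
    simp only [Real.rpow_zero, mul_one] at hi0
    have hiR : Integrable R γ := by simpa using h.integrable 1
    have hER : ∫ ω, R ω ∂γ = 1 := by simpa using h.integral_eq 1
    -- The linear term has mean zero because E R = 1, so only q² survives. As q ≤ 1/2 forces u ≥
    -- 1/2, u^(β-2) is at most 4u^β.
    have hpt : ∀ ω, (1 - q + q * R ω) ^ β ≤ 1 + β * q * (R ω - 1) +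
        β * (β - 1) * q ^ 2 * (2 * (R ω - 1) ^ 2 + 4 * ((R ω - 1) ^ 2 * (1 - q + q * R ω) ^ β)) := by
      intro ω
      have hu := mix_pos hq0 hq1 (h.pos ω)
      have hu2 : 1 / 2 ≤ 1 - q + q * R ω := by nlinarith [mul_nonneg hq0 (h.pos ω).le]
      have h1 := rpow_le_second_order hu hβ2
      have e : 1 - q + q * R ω - 1 = q * (R ω - 1) := by ring
      rw [e] at h1
      set u := 1 - q + q * R ω
      have h2 : u ^ (β - 2) ≤ 4 * u ^ β := by
        rw [Real.rpow_sub hu, Real.rpow_two, div_le_iff₀ (by positivity)]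
        have : 0 < u ^ β := Real.rpow_pos_of_pos hu _
        nlinarith [mul_le_mul hu2 hu2 (by norm_num) hu.le]
      have h3 : β * (β - 1) * (q * (R ω - 1)) ^ 2 * (1 + u ^ (β - 2)) ≤
          β * (β - 1) * (q * (R ω - 1)) ^ 2 * (2 + 4 * u ^ β) := by
        gcongr
        norm_num
      nlinarith
    have hiR1 : Integrable (fun ω => β * q * (R ω - 1)) γ :=
      (hiR.sub (integrable_const 1)).const_mul _
    have hirhs1 : Integrable (fun ω => 1 + β * q * (R ω - 1)) γ := (integrable_const 1).add hiR1
    have hirhs2 : Integrable (fun ω => 2 * (R ω - 1) ^ 2 +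
        4 * ((R ω - 1) ^ 2 * (1 - q + q * R ω) ^ β)) γ :=
      (hi0.const_mul 2).add (hint.const_mul 4)
    have h0 := integral_mono (h.integrable_mix_rpow hq0 hq1 hβ1)
      (hirhs1.add (hirhs2.const_mul (β * (β - 1) * q ^ 2))) hpt
    simp only [Pi.add_apply] at h0
    rw [integral_add hirhs1 (hirhs2.const_mul _), integral_const_mul,
      integral_add (hi0.const_mul 2) (hint.const_mul 4), integral_const_mul, integral_const_mul,
      integral_add (integrable_const 1) hiR1,
      integral_const_mul, integral_sub hiR (integrable_const 1), hER] at h0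
    simp only [integral_const, probReal_univ, one_smul, sub_self, mul_zero, add_zero] at h0
    have b0 := h.integral_sq_mul_rpow_le_exp (a := 0) hκ hκM hM (by norm_num)
    have b0' : ∫ ω, (R ω - 1) ^ 2 ∂γ ≤ 8 * M := by simpa using b0
    have e0 : (1 : ℝ) ≤ Real.exp (6 * z) := Real.one_le_exp (by positivity)
    -- 144 = 2·8 + 4·32.
    have h5 : 2 * ∫ ω, (R ω - 1) ^ 2 ∂γ +
        4 * ∫ ω, (R ω - 1) ^ 2 * (1 - q + q * R ω) ^ β ∂γ ≤ 144 * M * Real.exp (6 * z) := by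
      nlinarith
    have h5' := integral_nonneg (μ := γ) (f := fun ω => (R ω - 1) ^ 2) (fun ω => sq_nonneg _)
    have h6 : ∫ ω, (1 - q + q * R ω) ^ β ∂γ ≤ 1 + 288 * z * Real.exp (6 * z) := by
      refine h0.trans ?_
      have h7 : β * (β - 1) * q ^ 2 * (2 * ∫ ω, (R ω - 1) ^ 2 ∂γ +
        4 * ∫ ω, (R ω - 1) ^ 2 * (1 - q + q * R ω) ^ β ∂γ) ≤
          2 * β ^ 2 * q ^ 2 * (144 * M * Real.exp (6 * z)) := by
        refine (mul_le_mul_of_nonneg_left h5 (by positivity)).trans ?_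
        gcongr
      have h8 : 2 * β ^ 2 * q ^ 2 * (144 * M * Real.exp (6 * z)) = 288 * z * Real.exp (6 * z) := by
        rw [hz]; ring
      linarith
    have h9 : Real.exp (6 * z) ≤ Real.exp (288 * z) := Real.exp_le_exp.2 (by linarith)
    have h10 : 288 * z + 1 ≤ Real.exp (288 * z) := Real.add_one_le_exp _
    have h11 : Real.exp (576 * z) = Real.exp (288 * z) * Real.exp (288 * z) := by
      rw [← Real.exp_add]; ring_nf
    rw [h11]
    nlinarith [mul_le_mul_of_nonneg_left h9 (by positivity : 0 ≤ 288 * z)]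

end HasLogNormalMoments

/-! ### Translates of product Gaussian measures -/

/-- The density of `N(Δ, v)` with respect to `N(0, v)`. -/
noncomputable def shiftDensity (v : ℝ≥0) (Δ x : ℝ) : ℝ := Real.exp ((Δ * x - Δ ^ 2 / 2) / v)

lemma measurable_shiftDensity (v : ℝ≥0) (Δ : ℝ) : Measurable (shiftDensity v Δ) := by
  unfold shiftDensity
  fun_prop

lemma shiftDensity_rpow (v : ℝ≥0) (Δ x t : ℝ) :
    shiftDensity v Δ x ^ t = Real.exp (-(t * Δ ^ 2 / 2 / v)) * Real.exp (t * Δ / v * x) := by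
  rw [shiftDensity, ← Real.exp_mul, ← Real.exp_add]
  congr 1
  ring

lemma integrable_shiftDensity_rpow (v : ℝ≥0) (Δ t : ℝ) :
    Integrable (fun x => shiftDensity v Δ x ^ t) (gaussianReal 0 v) := by
  simp_rw [shiftDensity_rpow]
  exact (integrable_exp_mul_gaussianReal _).const_mul _

lemma integral_shiftDensity_rpow {v : ℝ≥0} (hv : v ≠ 0) (Δ t : ℝ) :
    ∫ x, shiftDensity v Δ x ^ t ∂gaussianReal 0 v =
      Real.exp (t * (t - 1) * (Δ ^ 2 / v) / 2) := by
  simp_rw [shiftDensity_rpow]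
  rw [integral_const_mul]
  have h := congrFun (mgf_fun_id_gaussianReal (μ := 0) (v := v)) (t * Δ / v)
  rw [mgf] at h
  rw [h, ← Real.exp_add]
  congr 1
  have : (v : ℝ) ≠ 0 := by exact_mod_cast hv
  field_simp
  ring

lemma gaussianReal_withDensity_shift {v : ℝ≥0} (hv : v ≠ 0) (Δ : ℝ) :
    (gaussianReal 0 v).withDensity (fun x => ENNReal.ofReal (shiftDensity v Δ x)) =
      gaussianReal Δ v := by
  rw [gaussianReal_of_var_ne_zero _ hv, gaussianReal_of_var_ne_zero _ hv,
    ← withDensity_mul _ (measurable_gaussianPDF _ _)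
      (measurable_shiftDensity v Δ).ennreal_ofReal]
  congr 1
  ext x
  have hv' : (v : ℝ) ≠ 0 := by exact_mod_cast hv
  simp only [Pi.mul_apply, gaussianPDF]
  rw [← ENNReal.ofReal_mul (gaussianPDFReal_nonneg _ _ _)]
  congr 1
  rw [gaussianPDFReal, gaussianPDFReal, shiftDensity, mul_assoc, ← Real.exp_add]
  congr 2
  field_simp
  ring

variable {ι : Type*} [Fintype ι]

/-- The density of a translate of a product of centered Gaussians. -/
noncomputable def piShiftDensity (v : ℝ≥0) (Δ z : ι → ℝ) : ℝ := ∏ i, shiftDensity v (Δ i) (z i)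

lemma measurable_piShiftDensity (v : ℝ≥0) (Δ : ι → ℝ) : Measurable (piShiftDensity v Δ) := by
  unfold piShiftDensity
  exact Finset.measurable_prod _ fun i _ =>
    (measurable_shiftDensity v (Δ i)).comp (measurable_pi_apply i)

lemma piShiftDensity_pos (v : ℝ≥0) (Δ z : ι → ℝ) : 0 < piShiftDensity v Δ z :=
  Finset.prod_pos fun _ _ => Real.exp_pos _

/-- By independence moments multiply and the parameters κ add up, so the number of coordinates
enters only through κ. -/
lemma hasLogNormalMoments_piShiftDensity {v : ℝ≥0} (hv : v ≠ 0) (Δ : ι → ℝ) :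
    HasLogNormalMoments (Measure.pi fun _ : ι => gaussianReal 0 v) (piShiftDensity v Δ)
      (∑ i, Δ i ^ 2 / v) where
  measurable := measurable_piShiftDensity v Δ
  pos := piShiftDensity_pos v Δ
  integrable t := by
    have : (fun z : ι → ℝ => piShiftDensity v Δ z ^ t) =
        fun z => ∏ i, shiftDensity v (Δ i) (z i) ^ t := by
      ext z
      exact (Real.finsetProd_rpow _ _ (fun i _ => (Real.exp_pos _).le) t).symm
    rw [this]
    exact Integrable.fintype_prod fun i => integrable_shiftDensity_rpow v (Δ i) t
  integral_eq t := by
    have : (fun z : ι → ℝ => piShiftDensity v Δ z ^ t) =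
        fun z => ∏ i, shiftDensity v (Δ i) (z i) ^ t := by
      ext z
      exact (Real.finsetProd_rpow _ _ (fun i _ => (Real.exp_pos _).le) t).symm
    rw [this, integral_fintype_prod_eq_prod (μ := fun _ : ι => gaussianReal 0 v)
      (fun i x => shiftDensity v (Δ i) x ^ t)]
    simp_rw [integral_shiftDensity_rpow hv]
    rw [← Real.exp_sum, Finset.mul_sum, Finset.sum_div]

lemma pi_gaussianReal_withDensity_shift {v : ℝ≥0} (hv : v ≠ 0) (Δ : ι → ℝ) :
    (Measure.pi fun _ : ι => gaussianReal 0 v).withDensity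
        (fun z => ENNReal.ofReal (piShiftDensity v Δ z)) =
      Measure.pi fun i => gaussianReal (Δ i) v := by
  symm
  refine Measure.pi_eq fun s hs => ?_
  have hint : ∀ i, Integrable (fun x => shiftDensity v (Δ i) x) (gaussianReal 0 v) := fun i => by
    simpa using integrable_shiftDensity_rpow v (Δ i) 1
  rw [withDensity_apply _ (MeasurableSet.univ_pi hs), Measure.restrict_pi_pi]
  simp only [piShiftDensity]
  rw [← ofReal_integral_eq_lintegral_ofReal
      (Integrable.fintype_prod (f := fun i x => shiftDensity v (Δ i) x)
        fun i => (hint i).integrableOn)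
      (ae_of_all _ fun z => (piShiftDensity_pos v Δ z).le),
    integral_fintype_prod_eq_prod (fun i x => shiftDensity v (Δ i) x),
    ENNReal.ofReal_prod_of_nonneg fun i _ =>
      integral_nonneg (f := fun x => shiftDensity v (Δ i) x) fun x => (Real.exp_pos _).le]
  refine Finset.prod_congr rfl fun i _ => ?_
  rw [← gaussianReal_withDensity_shift hv (Δ i), withDensity_apply _ (hs i),
    ofReal_integral_eq_lintegral_ofReal (hint i).integrableOn
      (ae_of_all _ fun z => (Real.exp_pos _).le)]

/-- Translation of a product of centered Gaussians as a change of density. -/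
lemma lintegral_pi_gaussianReal_add {v : ℝ≥0} (hv : v ≠ 0) (Δ : ι → ℝ) {h : (ι → ℝ) → ℝ≥0∞}
    (hh : Measurable h) :
    ∫⁻ z, h (Δ + z) ∂(Measure.pi fun _ : ι => gaussianReal 0 v) =
      ∫⁻ z, h z * ENNReal.ofReal (piShiftDensity v Δ z)
        ∂(Measure.pi fun _ : ι => gaussianReal 0 v) := by
  have h1 : (Measure.pi fun _ : ι => gaussianReal 0 v).map (fun z => Δ + z) =
      Measure.pi fun i => gaussianReal (Δ i) v := by
    have e : (fun z : ι → ℝ => Δ + z) = fun z i => Δ i + z i := rfl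
    have : ∀ i : ι, SigmaFinite ((gaussianReal 0 v).map (fun x => Δ i + x)) := fun i => by
      rw [gaussianReal_map_const_add]; infer_instance
    rw [e, Measure.pi_map_pi (f := fun i x => Δ i + x) fun i => by fun_prop]
    congr 1
    ext1 i
    rw [gaussianReal_map_const_add, zero_add]
  have hm : Measurable fun z : ι → ℝ => Δ + z := by fun_prop
  rw [← lintegral_map hh hm, h1, ← pi_gaussianReal_withDensity_shift hv,
    lintegral_withDensity_eq_lintegral_mul _ (measurable_piShiftDensity v Δ).ennreal_ofReal hh]
  simp [mul_comm]

/-! ### The subsampled Gaussian mechanism in dual form -/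

section Mixture

variable {Ω : Type*} [MeasurableSpace Ω] {γ : Measure Ω} [IsProbabilityMeasure γ] {R : Ω → ℝ}
  {κ : ℝ}

lemma HasLogNormalMoments.lintegral_mix_rpow_le (h : HasLogNormalMoments γ R κ) {q β M : ℝ}
    (hq0 : 0 ≤ q) (hq1 : q ≤ 1) (hκ : 0 ≤ κ) (hκM : κ ≤ M) (hM0 : 0 < M)
    (hβ : 2 ≤ β ∨ β ≤ -2) (hβM : |β| * M ≤ 1 / 4) :
    ∫⁻ ω, ENNReal.ofReal (1 - q + q * R ω) ^ β ∂γ ≤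
      ENNReal.ofReal (Real.exp (576 * (β ^ 2 * q ^ 2 * M))) := by
  have hpos := fun ω => mix_pos hq0 hq1 (h.pos ω)
  simp_rw [fun ω => ENNReal.ofReal_rpow_of_pos (p := β) (hpos ω)]
  rw [← ofReal_integral_eq_lintegral_ofReal
    (h.integrable_mix_rpow hq0 hq1 (hβ.imp (by intro h; linarith) (by intro h; linarith)))
    (ae_of_all _ fun ω => (Real.rpow_pos_of_pos (hpos ω) _).le)]
  exact ENNReal.ofReal_le_ofReal (h.integral_mix_rpow_le hq0 hq1 hκ hκM hM0 hβ hβM)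

/-- Hölder against the density u; the root 1/α turns the α² of the moment bound into α. -/
lemma HasLogNormalMoments.lintegral_mul_mix_le (h : HasLogNormalMoments γ R κ) {q α r M : ℝ}
    (hq0 : 0 ≤ q) (hq1 : q ≤ 1) (hκ : 0 ≤ κ) (hκM : κ ≤ M) (hM0 : 0 < M)
    (hα : 2 ≤ α) (hαM : α * M ≤ 1 / 4) (hr : α.HolderConjugate r) {g : Ω → ℝ≥0∞}
    (hg : Measurable g) :
    ∫⁻ ω, g ω * ENNReal.ofReal (1 - q + q * R ω) ∂γ ≤
      ENNReal.ofReal (Real.exp (576 * (α * q ^ 2 * M))) * (∫⁻ ω, g ω ^ r ∂γ) ^ (1 / r) := by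
  have hα0 : 0 < α := by linarith
  have hu : Measurable fun ω => ENNReal.ofReal (1 - q + q * R ω) := by
    have := h.measurable
    fun_prop
  have h1 := ENNReal.lintegral_mul_le_Lp_mul_Lq γ hr hu.aemeasurable hg.aemeasurable
  simp only [Pi.mul_apply] at h1
  simp_rw [mul_comm (g _)]
  refine h1.trans ?_
  gcongr
  have h2 := h.lintegral_mix_rpow_le hq0 hq1 hκ hκM hM0 (Or.inl hα)
    (by rwa [abs_of_pos hα0])
  calc _ ≤ (ENNReal.ofReal (Real.exp (576 * (α ^ 2 * q ^ 2 * M)))) ^ (1 / α) := by gcongr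
    _ = _ := by
      rw [ENNReal.ofReal_rpow_of_pos (Real.exp_pos _), ← Real.exp_mul]
      congr 2
      field_simp

/-- The reverse change of measure: Hölder for g = u^(-1/r) · (g u^(1/r)). As α/r = α - 1, this costs
the moment of u of order -(α-1), hence α ≥ 3. -/
lemma HasLogNormalMoments.lintegral_le_mul_mix (h : HasLogNormalMoments γ R κ) {q α r M : ℝ}
    (hq0 : 0 ≤ q) (hq1 : q ≤ 1) (hκ : 0 ≤ κ) (hκM : κ ≤ M) (hM0 : 0 < M)
    (hα : 3 ≤ α) (hαM : α * M ≤ 1 / 4) (hr : α.HolderConjugate r) {g : Ω → ℝ≥0∞}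
    (hg : Measurable g) :
    ∫⁻ ω, g ω ∂γ ≤ ENNReal.ofReal (Real.exp (576 * (α * q ^ 2 * M))) *
      (∫⁻ ω, g ω ^ r * ENNReal.ofReal (1 - q + q * R ω) ∂γ) ^ (1 / r) := by
  have hα0 : 0 < α := by linarith
  have hr0 : 0 < r := hr.symm.pos
  have hrα : α / r = α - 1 := by
    have := hr.inv_add_inv_eq_one
    have h2 : r⁻¹ = 1 - α⁻¹ := by linarith
    rw [div_eq_mul_inv, h2]
    field_simp
  set u := fun ω => ENNReal.ofReal (1 - q + q * R ω) with hudef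
  have hu : Measurable u := by
    have := h.measurable
    fun_prop
  have hu0 : ∀ ω, u ω ≠ 0 := fun ω => by
    simpa [hudef] using mix_pos hq0 hq1 (h.pos ω)
  have hut : ∀ ω, u ω ≠ ∞ := fun ω => ENNReal.ofReal_ne_top
  have h1 := ENNReal.lintegral_mul_le_Lp_mul_Lq γ hr (f := fun ω => u ω ^ (-(1 / r)))
    (g := fun ω => g ω * u ω ^ (1 / r)) (by fun_prop) (by fun_prop)
  have e1 : ∀ ω, ((fun ω => u ω ^ (-(1 / r))) * (fun ω => g ω * u ω ^ (1 / r))) ω = g ω := by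
    intro ω
    simp only [Pi.mul_apply]
    rw [mul_left_comm, ← ENNReal.rpow_add _ _ (hu0 ω) (hut ω)]
    simp
  have e2 : ∀ ω, (g ω * u ω ^ (1 / r)) ^ r = g ω ^ r * u ω := by
    intro ω
    rw [ENNReal.mul_rpow_of_nonneg _ _ hr0.le, ← ENNReal.rpow_mul, one_div_mul_cancel hr0.ne',
      ENNReal.rpow_one]
  have e3 : ∀ ω, (u ω ^ (-(1 / r))) ^ α = u ω ^ (-(α - 1)) := by
    intro ω
    rw [← ENNReal.rpow_mul, ← hrα]
    congr 1
    ring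
  simp_rw [e1, e2, e3] at h1
  refine h1.trans ?_
  gcongr
  have h2 := h.lintegral_mix_rpow_le (β := -(α - 1)) hq0 hq1 hκ hκM hM0 (Or.inr (by linarith))
    (by rw [abs_neg, abs_of_pos (by linarith)]; nlinarith)
  calc _ ≤ (ENNReal.ofReal (Real.exp (576 * ((-(α - 1)) ^ 2 * q ^ 2 * M)))) ^ (1 / α) := by
        gcongr
    _ ≤ _ := by
      rw [ENNReal.ofReal_rpow_of_pos (Real.exp_pos _), ← Real.exp_mul]
      apply ENNReal.ofReal_le_ofReal
      apply Real.exp_le_exp.2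
      rw [mul_one_div, div_le_iff₀ hα0]
      have : (-(α - 1)) ^ 2 * (q ^ 2 * M) ≤ α * α * (q ^ 2 * M) := by
        gcongr
        nlinarith
      nlinarith

end Mixture

lemma lintegral_mix_shift {v : ℝ≥0} (hv : v ≠ 0) {q : ℝ} (hq0 : 0 ≤ q) (hq1 : q ≤ 1)
    (Δ : ι → ℝ) {h : (ι → ℝ) → ℝ≥0∞} (hh : Measurable h) :
    ENNReal.ofReal (1 - q) * ∫⁻ z, h z ∂(Measure.pi fun _ : ι => gaussianReal 0 v) +
        ENNReal.ofReal q * ∫⁻ z, h (Δ + z) ∂(Measure.pi fun _ : ι => gaussianReal 0 v) =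
      ∫⁻ z, h z * ENNReal.ofReal (1 - q + q * piShiftDensity v Δ z)
        ∂(Measure.pi fun _ : ι => gaussianReal 0 v) := by
  have hhR : Measurable fun z => h z * ENNReal.ofReal (piShiftDensity v Δ z) :=
    hh.mul (measurable_piShiftDensity v Δ).ennreal_ofReal
  rw [lintegral_pi_gaussianReal_add hv Δ hh, ← lintegral_const_mul _ hh,
    ← lintegral_const_mul _ hhR, ← lintegral_add_left (hh.const_mul _)]
  refine lintegral_congr fun z => ?_
  rw [ENNReal.ofReal_add (sub_nonneg.2 hq1) (mul_nonneg hq0 (piShiftDensity_pos v Δ z).le),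
    ENNReal.ofReal_mul hq0]
  ring

/-- Dual Rényi bound between two mixtures of translated Gaussians sharing one component. -/
theorem lintegral_mix_gaussian_le {v : ℝ≥0} (hv : v ≠ 0) {q α r M : ℝ} (hq0 : 0 ≤ q)
    (hq1 : q ≤ 1) (hM0 : 0 < M) (hα : 3 ≤ α) (hαM : α * M ≤ 1 / 4) (hr : α.HolderConjugate r)
    {a b b' : ι → ℝ} (hb : ∑ i, (b i - a i) ^ 2 / v ≤ M) (hb' : ∑ i, (b' i - a i) ^ 2 / v ≤ M)
    {h : (ι → ℝ) → ℝ≥0∞} (hh : Measurable h) :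
    ENNReal.ofReal (1 - q) * ∫⁻ z, h (a + z) ∂(Measure.pi fun _ : ι => gaussianReal 0 v) +
        ENNReal.ofReal q * ∫⁻ z, h (b + z) ∂(Measure.pi fun _ : ι => gaussianReal 0 v) ≤
      ENNReal.ofReal (Real.exp (1152 * (α * q ^ 2 * M))) *
        (ENNReal.ofReal (1 - q) *
            ∫⁻ z, h (a + z) ^ (r * r) ∂(Measure.pi fun _ : ι => gaussianReal 0 v) +
          ENNReal.ofReal q *
            ∫⁻ z, h (b' + z) ^ (r * r) ∂(Measure.pi fun _ : ι => gaussianReal 0 v))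
          ^ (1 / (r * r)) := by
  set γ := Measure.pi fun _ : ι => gaussianReal 0 v with hγ
  have hr0 : 0 < r := hr.symm.pos
  have hr1 : 1 ≤ r := hr.symm.lt.le
  -- Translating by a centres the shared component, which becomes the reference measure.
  set k : (ι → ℝ) → ℝ≥0∞ := fun z => h (a + z) with hk
  have hkm : Measurable k := hh.comp (by fun_prop)
  have eb : ∀ (c : ι → ℝ) (z : ι → ℝ), h (c + z) = k ((c - a) + z) := fun c z => by
    simp only [hk]; congr 1; abel
  simp_rw [eb b, eb b']
  change ENNReal.ofReal (1 - q) * ∫⁻ z, k z ∂γ + _ ≤ _ * (ENNReal.ofReal (1 - q) *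
    ∫⁻ z, k z ^ (r * r) ∂γ + _) ^ _
  rw [lintegral_mix_shift hv hq0 hq1 _ hkm,
    lintegral_mix_shift hv hq0 hq1 _ (hkm.pow_const (r * r))]
  have hs : ∀ c : ι → ℝ, 0 ≤ ∑ i, (c - a) i ^ 2 / (v : ℝ) := fun c => by positivity
  have h1 := (hasLogNormalMoments_piShiftDensity hv (b - a)).lintegral_mul_mix_le hq0 hq1
    (hs b) hb hM0 (by linarith) hαM hr hkm
  -- The second leg is applied to k^r, so the exponents of the two legs multiply to r·r.
  have h2 := (hasLogNormalMoments_piShiftDensity hv (b' - a)).lintegral_le_mul_mix hq0 hq1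
    (hs b') hb' hM0 hα hαM hr (hkm.pow_const r)
  simp_rw [← ENNReal.rpow_mul] at h2
  set A := Real.exp (576 * (α * q ^ 2 * M)) with hA
  have hA1 : 1 ≤ A := Real.one_le_exp (by positivity)
  have hAA : Real.exp (1152 * (α * q ^ 2 * M)) = A * A := by
    rw [hA, ← Real.exp_add]; ring_nf
  refine h1.trans ?_
  calc _ ≤ ENNReal.ofReal A * (ENNReal.ofReal A * (∫⁻ z, k z ^ (r * r) *
          ENNReal.ofReal (1 - q + q * piShiftDensity v (b' - a) z) ∂γ) ^ (1 / r)) ^ (1 / r) := by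
        gcongr
    _ ≤ ENNReal.ofReal A * (ENNReal.ofReal A * ((∫⁻ z, k z ^ (r * r) *
          ENNReal.ofReal (1 - q + q * piShiftDensity v (b' - a) z) ∂γ) ^ (1 / r)) ^ (1 / r)) := by
        rw [ENNReal.mul_rpow_of_nonneg _ _ (by positivity)]
        gcongr
        rw [ENNReal.ofReal_rpow_of_pos (Real.exp_pos _)]
        apply ENNReal.ofReal_le_ofReal
        exact Real.rpow_le_self_of_one_le hA1 (by rw [div_le_one hr0]; exact hr1)
    _ = _ := by
        rw [hAA, ENNReal.ofReal_mul (by positivity), ← ENNReal.rpow_mul, mul_assoc,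
          one_div_mul_one_div]

/-! ### Rényi divergence bounds in dual form -/

/-- Dual form of a Rényi divergence bound: with `1 / a + 1 / r = 1`, it says that the density of
`μ` with respect to `ν` has norm at most `A` in `L^a(ν)`. -/
def DualRenyi {Y : Type*} [MeasurableSpace Y] (r : ℝ) (A : ℝ≥0∞) (μ ν : Measure Y) : Prop :=
  ∀ g : Y → ℝ≥0∞, Measurable g → ∫⁻ y, g y ∂μ ≤ A * (∫⁻ y, g y ^ r ∂ν) ^ (1 / r)

namespace DualRenyi

variable {Y Z : Type*} [MeasurableSpace Y] [MeasurableSpace Z] {r : ℝ} {A B : ℝ≥0∞}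

lemma refl (hr : 1 < r) (μ : Measure Y) [IsProbabilityMeasure μ] : DualRenyi r 1 μ μ := by
  intro g hg
  have h := ENNReal.lintegral_mul_le_Lp_mul_Lq μ (Real.HolderConjugate.conjExponent hr)
    hg.aemeasurable (aemeasurable_const (b := (1 : ℝ≥0∞)))
  simpa using h

/-- Adaptive composition. -/
lemma bind (hr : 0 < r) {μ ν : Measure Y} {κ η : Y → Measure Z} (h : DualRenyi r A μ ν)
    (hκ : Measurable κ) (hη : Measurable η) (hκη : ∀ y, DualRenyi r B (κ y) (η y)) :
    DualRenyi r (A * B) (μ.bind κ) (ν.bind η) := by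
  intro g hg
  have hF : Measurable fun y => ∫⁻ z, g z ^ r ∂η y :=
    (Measure.measurable_lintegral (hg.pow_const r)).comp hη
  rw [Measure.lintegral_bind hκ.aemeasurable hg.aemeasurable,
    Measure.lintegral_bind hη.aemeasurable (hg.pow_const r).aemeasurable]
  calc ∫⁻ y, ∫⁻ z, g z ∂κ y ∂μ ≤ ∫⁻ y, B * (∫⁻ z, g z ^ r ∂η y) ^ (1 / r) ∂μ :=
        lintegral_mono fun y => hκη y g hg
    _ = B * ∫⁻ y, (∫⁻ z, g z ^ r ∂η y) ^ (1 / r) ∂μ := lintegral_const_mul _ (hF.pow_const _)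
    _ ≤ B * (A * (∫⁻ y, ((∫⁻ z, g z ^ r ∂η y) ^ (1 / r)) ^ r ∂ν) ^ (1 / r)) := by
        gcongr
        exact h _ (hF.pow_const _)
    _ = A * B * (∫⁻ y, ∫⁻ z, g z ^ r ∂η y ∂ν) ^ (1 / r) := by
        simp_rw [← ENNReal.rpow_mul, one_div_mul_cancel hr.ne', ENNReal.rpow_one]
        ring

/-- Joint convexity. -/
lemma sum_smul {ι : Type*} (hr : 1 ≤ r) {s : Finset ι} {w : ι → ℝ≥0∞} (hw : ∑ i ∈ s, w i = 1)
    {μ ν : ι → Measure Y} (h : ∀ i ∈ s, DualRenyi r A (μ i) (ν i)) :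
    DualRenyi r A (∑ i ∈ s, w i • μ i) (∑ i ∈ s, w i • ν i) := by
  intro g hg
  have hr0 : 0 < r := by linarith
  simp only [lintegral_finsetSum_measure, lintegral_smul_measure, smul_eq_mul]
  calc ∑ i ∈ s, w i * ∫⁻ y, g y ∂μ i
      ≤ ∑ i ∈ s, w i * (A * (∫⁻ y, g y ^ r ∂ν i) ^ (1 / r)) :=
        Finset.sum_le_sum fun i hi => mul_le_mul_right (h i hi g hg) _
    _ = A * ∑ i ∈ s, w i * (∫⁻ y, g y ^ r ∂ν i) ^ (1 / r) := by
        rw [Finset.mul_sum]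
        exact Finset.sum_congr rfl fun i _ => by ring
    _ ≤ A * (∑ i ∈ s, w i * ∫⁻ y, g y ^ r ∂ν i) ^ (1 / r) := by
        gcongr
        have := ENNReal.rpow_arith_mean_le_arith_mean_rpow s w
          (fun i => (∫⁻ y, g y ^ r ∂ν i) ^ (1 / r)) hw hr
        simp_rw [← ENNReal.rpow_mul, one_div_mul_cancel hr0.ne', ENNReal.rpow_one] at this
        calc _ = ((∑ i ∈ s, w i * (∫⁻ y, g y ^ r ∂ν i) ^ (1 / r)) ^ r) ^ (1 / r) := by
              rw [← ENNReal.rpow_mul, mul_one_div_cancel hr0.ne', ENNReal.rpow_one]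
          _ ≤ _ := by gcongr

/-- Conversion to an `(ε, δ)`-bound. -/
lemma measure_le {μ ν : Measure Y} [IsProbabilityMeasure μ] [IsProbabilityMeasure ν] {a ε δ : ℝ}
    (hr : 1 < r) (h : DualRenyi r (ENNReal.ofReal (Real.exp a)) μ ν) (hδ : 0 < δ)
    (hle : a - ε / r ≤ (1 - 1 / r) * Real.log δ) {s : Set Y} (hs : MeasurableSet s) :
    μ s ≤ ENNReal.ofReal (Real.exp ε) * ν s + ENNReal.ofReal δ := by
  have hr0 : 0 < r := by linarith
  -- An indicator equals its r-th power, so this reads μ(s) ≤ e^a ν(s)^(1/r).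
  have h1 := h (s.indicator 1) (measurable_one.indicator hs)
  have e : ∀ y, (s.indicator (1 : Y → ℝ≥0∞) y) ^ r = s.indicator 1 y := fun y => by
    by_cases hy : y ∈ s <;> simp [hy, hr0]
  simp_rw [e] at h1
  rw [lintegral_indicator_one hs, lintegral_indicator_one hs] at h1
  have hμ : μ s = ENNReal.ofReal (μ.real s) := (ofReal_measureReal).symm
  have hν : ν s = ENNReal.ofReal (ν.real s) := (ofReal_measureReal).symm
  have hμ0 : 0 ≤ μ.real s := measureReal_nonneg
  have hν0 : 0 ≤ ν.real s := measureReal_nonneg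
  rw [hμ, hν] at h1 ⊢
  generalize μ.real s = x at *
  generalize ν.real s = y at *
  rw [ENNReal.ofReal_rpow_of_nonneg hν0 (by positivity), ← ENNReal.ofReal_mul (by positivity),
    ENNReal.ofReal_le_ofReal_iff (by positivity)] at h1
  rw [← ENNReal.ofReal_mul (by positivity), ← ENNReal.ofReal_add (by positivity) hδ.le]
  apply ENNReal.ofReal_le_ofReal
  -- If the bound fails, then μ(s) > δ and ν(s) ≤ e^(-ε) μ(s). Inserting the latter in `h1` gives (1
  -- - 1/r) log μ(s) ≤ a - ε/r, against `hle`.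
  by_contra! hcon
  have hx : 0 < x := lt_of_le_of_lt (by positivity) hcon
  have hxδ : δ < x := by nlinarith [mul_nonneg (Real.exp_pos ε).le hν0]
  have hy : y ≤ Real.exp (-ε) * x := by
    rw [Real.exp_neg, ← div_eq_inv_mul, le_div_iff₀ (Real.exp_pos _)]
    linarith
  have h2 : x ≤ Real.exp a * (Real.exp (-ε) * x) ^ (1 / r) := h1.trans (by gcongr)
  rw [Real.mul_rpow (Real.exp_pos _).le hx.le, ← Real.exp_mul, Real.rpow_def_of_pos hx,
    ← Real.exp_add, ← Real.exp_add] at h2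
  have h3 : Real.log x ≤ a + (-ε * (1 / r) + Real.log x * (1 / r)) := by
    rwa [Real.log_le_iff_le_exp hx]
  have h4 : Real.log δ < Real.log x := Real.log_lt_log hδ hxδ
  have h5 : 1 / r < 1 := by rw [div_lt_one hr0]; exact hr
  have h6 : (1 - 1 / r) * Real.log δ < (1 - 1 / r) * Real.log x :=
    mul_lt_mul_of_pos_left h4 (by linarith)
  have h7 : ε / r = ε * (1 / r) := by ring
  nlinarith

end DualRenyi

/-! ### Sampling without replacement -/

section Sampling

variable {n : ℕ}

/-- Pairs of an `m`-subset containing `i₀` and an index outside of it. -/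
def swapPairs (m : ℕ) (i₀ : Fin n) : Finset (Σ _ : Finset (Fin n), Fin n) :=
  ((Finset.powersetCard m Finset.univ).filter (i₀ ∈ ·)).sigma fun B => Bᶜ

/-- The subset obtained from `x.1` by exchanging `i₀` with `x.2`. -/
def swapSet (i₀ : Fin n) (x : Σ _ : Finset (Fin n), Fin n) : Finset (Fin n) :=
  insert x.2 (x.1.erase i₀)

lemma mem_swapPairs {m : ℕ} {i₀ : Fin n} {x : Σ _ : Finset (Fin n), Fin n} :
    x ∈ swapPairs m i₀ ↔ (x.1.card = m ∧ i₀ ∈ x.1) ∧ x.2 ∉ x.1 := by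
  simp [swapPairs, Finset.mem_powersetCard]

variable {N : Type*} [AddCommMonoid N]

lemma sum_swapPairs_fst (m : ℕ) (i₀ : Fin n) (ψ : Finset (Fin n) → N) :
    ∑ x ∈ swapPairs m i₀, ψ x.1 =
      (n - m) • ∑ B ∈ (Finset.powersetCard m Finset.univ).filter (i₀ ∈ ·), ψ B := by
  rw [swapPairs, Finset.sum_sigma, Finset.smul_sum]
  refine Finset.sum_congr rfl fun B hB => ?_
  simp only [Finset.mem_filter, Finset.mem_powersetCard] at hB
  simp only
  rw [Finset.sum_const, Finset.card_compl, Fintype.card_fin, hB.1.2]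

/-- The exchange is a bijection onto pairs of an m-subset avoiding i₀ and one of its elements, so
each such subset is reached m times. -/
lemma sum_swapPairs_swapSet (m : ℕ) (i₀ : Fin n) (ψ : Finset (Fin n) → N) :
    ∑ x ∈ swapPairs m i₀, ψ (swapSet i₀ x) =
      m • ∑ B ∈ (Finset.powersetCard m Finset.univ).filter (i₀ ∉ ·), ψ B := by
  have h : m • ∑ B ∈ (Finset.powersetCard m Finset.univ).filter (i₀ ∉ ·), ψ B =
      ∑ x ∈ ((Finset.powersetCard m Finset.univ).filter (i₀ ∉ ·)).sigma
        (fun B : Finset (Fin n) => B), ψ x.1 := by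
    rw [Finset.sum_sigma, Finset.smul_sum]
    refine Finset.sum_congr rfl fun B hB => ?_
    simp only [Finset.mem_filter, Finset.mem_powersetCard] at hB
    simp only
    rw [Finset.sum_const, hB.1.2]
  rw [h]
  refine Finset.sum_bij' (fun x _ => ⟨swapSet i₀ x, x.2⟩)
    (fun x _ => ⟨insert i₀ (x.1.erase x.2), x.2⟩) ?_ ?_ ?_ ?_ ?_
  · rintro ⟨B, j⟩ hx
    obtain ⟨⟨hc, hi⟩, hj⟩ := mem_swapPairs.1 hx
    have hij : i₀ ≠ j := fun h => hj (h ▸ hi)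
    have hm : 0 < B.card := Finset.card_pos.2 ⟨_, hi⟩
    simp only [swapSet, Finset.mem_sigma, Finset.mem_filter, Finset.mem_powersetCard,
      Finset.subset_univ, true_and, Finset.mem_insert, Finset.mem_erase, true_or, and_true]
    refine ⟨?_, by simp [hij]⟩
    rw [Finset.card_insert_of_notMem (by simp [hj]), Finset.card_erase_of_mem hi]
    change B.card = m at hc
    change B.card - 1 + 1 = m
    omega
  · rintro ⟨B, j⟩ hx
    simp only [Finset.mem_sigma, Finset.mem_filter, Finset.mem_powersetCard,
      Finset.subset_univ, true_and] at hx
    obtain ⟨⟨hc, hi⟩, hj⟩ := hx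
    have hij : j ≠ i₀ := fun h => hi (h ▸ hj)
    have hm : 0 < B.card := Finset.card_pos.2 ⟨_, hj⟩
    rw [mem_swapPairs]
    refine ⟨⟨?_, by simp⟩, by simp [hij]⟩
    rw [Finset.card_insert_of_notMem (by simp [hi]), Finset.card_erase_of_mem hj]
    omega
  · rintro ⟨B, j⟩ hx
    obtain ⟨⟨hc, hi⟩, hj⟩ := mem_swapPairs.1 hx
    simp only [swapSet]
    rw [Finset.erase_insert (by simp [hj]), Finset.insert_erase hi]
  · rintro ⟨B, j⟩ hx
    simp only [Finset.mem_sigma, Finset.mem_filter, Finset.mem_powersetCard,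
      Finset.subset_univ, true_and] at hx
    obtain ⟨⟨hc, hi⟩, hj⟩ := hx
    simp only [swapSet]
    rw [Finset.erase_insert (by simp [hi]), Finset.insert_erase hj]
  · intro x _
    rfl

/-- The common weight of the pairs in `swapPairs`. -/
noncomputable def swapWeight (n m : ℕ) : ℝ≥0∞ :=
  ENNReal.ofReal (n / (n.choose m * m * (n - m)))

lemma swapWeight_mul_fst {m : ℕ} (hm : 1 ≤ m) (hmn : m < n) :
    swapWeight n m * ENNReal.ofReal (m / n) * ((n - m : ℕ) : ℝ≥0∞) = (n.choose m : ℝ≥0∞)⁻¹ := by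
  have h1 : (0 : ℝ) < n.choose m := by exact_mod_cast Nat.choose_pos hmn.le
  have h2 : (0 : ℝ) < m := by exact_mod_cast hm
  have h3 : (0 : ℝ) < n - m := by rw [sub_pos]; exact_mod_cast hmn
  have h4 : (0 : ℝ) < n := by linarith
  rw [swapWeight, ← ENNReal.ofReal_natCast (n - m), ← ENNReal.ofReal_natCast (n.choose m),
    ← ENNReal.ofReal_inv_of_pos h1, ← ENNReal.ofReal_mul (by positivity),
    ← ENNReal.ofReal_mul (by positivity), Nat.cast_sub hmn.le]
  congr 1
  field_simp

lemma swapWeight_mul_swapSet {m : ℕ} (hm : 1 ≤ m) (hmn : m < n) :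
    swapWeight n m * ENNReal.ofReal (1 - m / n) * (m : ℝ≥0∞) = (n.choose m : ℝ≥0∞)⁻¹ := by
  have h1 : (0 : ℝ) < n.choose m := by exact_mod_cast Nat.choose_pos hmn.le
  have h2 : (0 : ℝ) < m := by exact_mod_cast hm
  have h3 : (0 : ℝ) < n - m := by rw [sub_pos]; exact_mod_cast hmn
  have h4 : (0 : ℝ) < n := by linarith
  have h5 : (1 : ℝ) - m / n = (n - m) / n := by field_simp
  rw [swapWeight, h5, ← ENNReal.ofReal_natCast m, ← ENNReal.ofReal_natCast (n.choose m),
    ← ENNReal.ofReal_inv_of_pos h1, ← ENNReal.ofReal_mul (by positivity),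
    ← ENNReal.ofReal_mul (by positivity)]
  congr 1
  field_simp

/-- Uniform sampling of an `m`-subset as a mixture over pairs of neighbouring subsets. -/
lemma sum_powersetCard_eq_sum_swapPairs {Y : Type*} [MeasurableSpace Y] {m : ℕ} (hm : 1 ≤ m)
    (hmn : m < n) (i₀ : Fin n) (ν : Finset (Fin n) → Measure Y) :
    (n.choose m : ℝ≥0∞)⁻¹ • ∑ B ∈ Finset.powersetCard m Finset.univ, ν B =
      ∑ x ∈ swapPairs m i₀, swapWeight n m •
        (ENNReal.ofReal (1 - m / n) • ν (swapSet i₀ x) + ENNReal.ofReal (m / n) • ν x.1) := by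
  rw [← Finset.smul_sum, Finset.sum_add_distrib, ← Finset.smul_sum, ← Finset.smul_sum,
    sum_swapPairs_fst, sum_swapPairs_swapSet, ← Nat.cast_smul_eq_nsmul ℝ≥0∞,
    ← Nat.cast_smul_eq_nsmul ℝ≥0∞, smul_add, smul_smul, smul_smul, smul_smul, smul_smul,
    swapWeight_mul_fst hm hmn, swapWeight_mul_swapSet hm hmn,
    ← smul_add, add_comm (∑ B ∈ _ with i₀ ∉ B, ν B), Finset.sum_filter_add_sum_filter_not]

/-- Evaluating the decomposition on point masses gives the normalization without counting pairs. -/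
lemma sum_swapWeight {m : ℕ} (hm : 1 ≤ m) (hmn : m < n) (i₀ : Fin n) :
    ∑ _x ∈ swapPairs m i₀, swapWeight n m = 1 := by
  have h := congrArg (fun μ : Measure Unit => μ Set.univ)
    (sum_powersetCard_eq_sum_swapPairs hm hmn i₀ fun _ => Measure.dirac ())
  have hq : (m : ℝ) / n ≤ 1 := div_le_one_of_le₀ (by exact_mod_cast hmn.le) (by positivity)
  have hw : ENNReal.ofReal (1 - m / n) + ENNReal.ofReal (m / n) = 1 := by
    rw [← ENNReal.ofReal_add (by linarith) (by positivity)]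
    simp
  have hc : (n.choose m : ℝ≥0∞) ≠ 0 := by exact_mod_cast (Nat.choose_pos hmn.le).ne'
  simp only [Measure.smul_apply, Measure.add_apply, measure_univ,
    smul_eq_mul, mul_one, hw, Finset.sum_const, Finset.card_powersetCard, Finset.card_univ,
    Fintype.card_fin, nsmul_eq_mul] at h
  rw [ENNReal.inv_mul_cancel hc (ENNReal.natCast_ne_top _)] at h
  rw [Finset.sum_const, nsmul_eq_mul, ← h]

end Sampling

/-! ### Sensitivity of the clipped gradient estimates -/

lemma abs_clip_le {C : ℝ} (hC : 0 < C) (g : ℝ) : |clip C g| ≤ C := by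
  have h1 : 0 < max 1 (|g| / C) := lt_max_of_lt_left one_pos
  rw [clip, abs_div, abs_of_pos h1, div_le_iff₀ h1]
  calc |g| = C * (|g| / C) := by field_simp
    _ ≤ _ := by gcongr; exact le_max_right _ _

lemma measurable_clip (C : ℝ) : Measurable (clip C) :=
  measurable_id.div (measurable_const.max (measurable_id.abs.div_const C))

section Algorithm

variable {X : Type*} {d n : ℕ} (c : Config) (f : Param d → X → ℝ) (D : Fin n → X)

/-- The sum over the minibatch before the noise is added, in every direction. -/
noncomputable def batchSum (s : ℕ) (θ₀ θ : Param d) (B : Finset (Fin n)) (v : Fin c.P → Param d) :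
    Fin c.P → ℝ := fun p =>
  ∑ i ∈ B, (clip c.C (finiteDiff f (c.β s) θ (v p) (D i)) + 1 / c.lam * ‖θ - θ₀‖)

/-- The update as a function of the noisy sums. -/
noncomputable def applySums (s : ℕ) (θ : Param d) (v : Fin c.P → Param d) (u : Fin c.P → ℝ) :
    Param d :=
  θ - c.η s • ((1 / (c.P : ℝ)) • ∑ p, (1 / (c.m : ℝ) * u p) • v p)

/-- Given the directions, the data enter only through the noisy scalars; the rest is
post-processing. -/
lemma update_eq_applySums (s : ℕ) (θ₀ θ : Param d) (B : Finset (Fin n)) (v : Fin c.P → Param d)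
    (z : Fin c.P → ℝ) :
    update c f D s θ₀ θ B v z = applySums c s θ v (batchSum c f D s θ₀ θ B v + z) := rfl

/-! ### Measurability and total mass of the law of one iteration. -/

variable {c f}

lemma measurable_update (hf : ∀ x, Measurable fun θ => f θ x) (s : ℕ) (B : Finset (Fin n)) :
    Measurable fun x : (Param d × Param d) × ((Fin c.P → Param d) × (Fin c.P → ℝ)) =>
      update c f D s x.1.1 x.1.2 B x.2.1 x.2.2 := by
  have hfd : ∀ (p : Fin c.P) (i : Fin n), Measurable
      fun x : (Param d × Param d) × ((Fin c.P → Param d) × (Fin c.P → ℝ)) =>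
        clip c.C (finiteDiff f (c.β s) x.1.2 (x.2.1 p) (D i)) := by
    intro p i
    refine (measurable_clip _).comp ?_
    unfold finiteDiff
    refine Measurable.const_mul (Measurable.sub ?_ ?_) _
    · exact (hf (D i)).comp (by fun_prop)
    · exact (hf (D i)).comp (by fun_prop)
  unfold update
  fun_prop

lemma measurable_applySums (s : ℕ) (θ : Param d) (v : Fin c.P → Param d) :
    Measurable (applySums c s θ v) := by
  unfold applySums
  fun_prop

variable (c f)

/-- The law of one iteration given the minibatch. -/
noncomputable def batchLaw (s : ℕ) (θ₀ θ : Param d) (B : Finset (Fin n)) : Measure (Param d) :=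
  ((Measure.pi fun _ : Fin c.P => stdGaussian (Param d)).prod
    (Measure.pi fun _ : Fin c.P => gaussianReal 0 (Real.toNNReal (c.σ ^ 2 * c.C ^ 2)))).map
      fun w => update c f D s θ₀ θ B w.1 w.2

lemma stepLaw_eq (s : ℕ) (θ₀ θ : Param d) :
    stepLaw c f D s θ₀ θ = ((n.choose c.m : ℝ≥0∞)⁻¹) •
      ∑ B ∈ Finset.powersetCard c.m (Finset.univ : Finset (Fin n)), batchLaw c f D s θ₀ θ B := rfl

variable {c f}

lemma measurable_update_right (hf : ∀ x, Measurable fun θ => f θ x) (s : ℕ) (θ₀ θ : Param d)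
    (B : Finset (Fin n)) :
    Measurable fun w : (Fin c.P → Param d) × (Fin c.P → ℝ) =>
      update c f D s θ₀ θ B w.1 w.2 :=
  (measurable_update (c := c) D hf s B).comp
    ((measurable_const (a := (θ₀, θ))).prodMk measurable_id)

lemma isProbabilityMeasure_batchLaw (hf : ∀ x, Measurable fun θ => f θ x) (s : ℕ)
    (θ₀ θ : Param d) (B : Finset (Fin n)) : IsProbabilityMeasure (batchLaw c f D s θ₀ θ B) :=
  Measure.isProbabilityMeasure_map (measurable_update_right D hf s θ₀ θ B).aemeasurable

lemma isProbabilityMeasure_stepLaw (hf : ∀ x, Measurable fun θ => f θ x) (hmn : c.m ≤ n) (s : ℕ)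
    (θ₀ θ : Param d) : IsProbabilityMeasure (stepLaw c f D s θ₀ θ) := by
  constructor
  have := isProbabilityMeasure_batchLaw (c := c) D hf s θ₀ θ
  have hc : (n.choose c.m : ℝ≥0∞) ≠ 0 := by exact_mod_cast (Nat.choose_pos hmn).ne'
  rw [stepLaw_eq, Measure.smul_apply, Measure.finsetSum_apply]
  simp only [measure_univ, Finset.sum_const, Finset.card_powersetCard, Finset.card_univ,
    Fintype.card_fin, nsmul_eq_mul, smul_eq_mul, mul_one]
  exact ENNReal.inv_mul_cancel hc (ENNReal.natCast_ne_top _)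

lemma measurable_stepLaw (hf : ∀ x, Measurable fun θ => f θ x) (s : ℕ) :
    Measurable fun x : Param d × Param d => stepLaw c f D s x.1 x.2 := by
  refine Measure.measurable_of_measurable_coe _ fun t ht => ?_
  simp only [stepLaw_eq, Measure.smul_apply, Measure.finsetSum_apply, smul_eq_mul]
  refine Measurable.const_mul (Finset.measurable_sum _ fun B _ => ?_) _
  have h := measurable_update (c := c) D hf s B
  have := measurable_measure_prodMk_left
    (ν := (Measure.pi fun _ : Fin c.P => stdGaussian (Param d)).prod
      (Measure.pi fun _ : Fin c.P => gaussianReal 0 (Real.toNNReal (c.σ ^ 2 * c.C ^ 2)))) (h ht)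
  convert this using 2 with x
  rw [batchLaw, Measure.map_apply (measurable_update_right D hf s x.1 x.2 B) ht]
  rfl

/-! ### Measurability of the laws of the iterates -/

lemma measurable_bind_kernel {Y Z W : Type*} [MeasurableSpace Y] [MeasurableSpace Z]
    [MeasurableSpace W] {κ : Y → Measure Z} (hκ : Measurable κ)
    (hκ' : ∀ y, IsProbabilityMeasure (κ y)) {η : Y → Z → Measure W}
    (hη : Measurable fun x : Y × Z => η x.1 x.2) : Measurable fun y => (κ y).bind (η y) := by
  refine Measure.measurable_of_measurable_coe _ fun t ht => ?_
  let K : Kernel Y Z := ⟨κ, hκ⟩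
  have : IsMarkovKernel K := ⟨hκ'⟩
  have h1 : Measurable fun x : Y × Z => η x.1 x.2 t := (Measure.measurable_coe ht).comp hη
  have h2 := h1.lintegral_kernel_prod_right' (κ := K)
  convert h2 using 2 with y
  have hηy : Measurable (η y) := hη.comp measurable_prodMk_left
  rw [Measure.bind_apply ht hηy.aemeasurable]
  rfl

/-- The two claims are proved together because measurability of the next bind uses that the current
laws are probability measures. -/
lemma measurable_innerLaw_and_isProbabilityMeasure (hf : ∀ x, Measurable fun θ => f θ x) (hmn : c.m ≤ n) (s t : ℕ) :
    Measurable (fun θ₀ => innerLaw c f D s θ₀ t) ∧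
      ∀ θ₀, IsProbabilityMeasure (innerLaw c f D s θ₀ t) := by
  induction t with
  | zero => exact ⟨Measure.measurable_dirac, fun θ₀ => Measure.dirac.isProbabilityMeasure⟩
  | succ t ih =>
    have hs := measurable_stepLaw (c := c) D hf s
    refine ⟨measurable_bind_kernel ih.1 ih.2 hs, fun θ₀ => ?_⟩
    have := ih.2 θ₀
    exact isProbabilityMeasure_bind (hs.comp measurable_prodMk_left).aemeasurable
      (ae_of_all _ fun θ => isProbabilityMeasure_stepLaw D hf hmn s θ₀ θ)

lemma isProbabilityMeasure_stageLaw (hf : ∀ x, Measurable fun θ => f θ x) (hmn : c.m ≤ n)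
    (θinit : Param d) (s : ℕ) : IsProbabilityMeasure (stageLaw c f D θinit s) := by
  induction s with
  | zero => exact Measure.dirac.isProbabilityMeasure
  | succ s ih =>
    exact isProbabilityMeasure_bind (measurable_innerLaw_and_isProbabilityMeasure D hf hmn _ _).1.aemeasurable
      (ae_of_all _ fun θ => (measurable_innerLaw_and_isProbabilityMeasure D hf hmn _ _).2 θ)

/-! ### Privacy of one iteration -/

variable {D}

/-- Both batches have as many elements, so the regularization terms cancel and only one clipped
difference, bounded by C, is replaced by another. -/
lemma abs_batchSum_sub_le (hC : 0 < c.C) {D' : Fin n → X} (s : ℕ) (θ₀ θ : Param d)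
    {B B' E : Finset (Fin n)} {i j : Fin n} (hi : i ∉ E) (hj : j ∉ E) (hB : B = insert i E)
    (hB' : B' = insert j E) (hD : ∀ k ∈ E, D k = D' k) (v : Fin c.P → Param d) (p : Fin c.P) :
    |batchSum c f D s θ₀ θ B v p - batchSum c f D' s θ₀ θ B' v p| ≤ 2 * c.C := by
  subst hB hB'
  have h : ∑ k ∈ E, (clip c.C (finiteDiff f (c.β s) θ (v p) (D k)) + 1 / c.lam * ‖θ - θ₀‖) =
      ∑ k ∈ E, (clip c.C (finiteDiff f (c.β s) θ (v p) (D' k)) + 1 / c.lam * ‖θ - θ₀‖) :=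
    Finset.sum_congr rfl fun k hk => by rw [hD k hk]
  rw [batchSum, batchSum, Finset.sum_insert hi, Finset.sum_insert hj, h]
  have h1 := abs_le.1 (abs_clip_le hC (finiteDiff f (c.β s) θ (v p) (D i)))
  have h2 := abs_le.1 (abs_clip_le hC (finiteDiff f (c.β s) θ (v p) (D' j)))
  rw [abs_le]
  constructor <;> linarith [h1.1, h1.2, h2.1, h2.2]

lemma lintegral_batchLaw (hf : ∀ x, Measurable fun θ => f θ x) (s : ℕ) (θ₀ θ : Param d)
    (B : Finset (Fin n)) {g : Param d → ℝ≥0∞} (hg : Measurable g) :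
    ∫⁻ y, g y ∂batchLaw c f D s θ₀ θ B =
      ∫⁻ v, ∫⁻ z, g (applySums c s θ v (batchSum c f D s θ₀ θ B v + z))
        ∂(Measure.pi fun _ : Fin c.P => gaussianReal 0 (Real.toNNReal (c.σ ^ 2 * c.C ^ 2)))
        ∂(Measure.pi fun _ : Fin c.P => stdGaussian (Param d)) := by
  have hu := measurable_update_right (c := c) D hf s θ₀ θ B
  rw [batchLaw, lintegral_map hg hu,
    lintegral_prod (fun w => g (update c f D s θ₀ θ B w.1 w.2)) (hg.comp hu).aemeasurable]
  simp only [update_eq_applySums]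

lemma measurable_inner_lintegral (hf : ∀ x, Measurable fun θ => f θ x) (s : ℕ) (θ₀ θ : Param d)
    (B : Finset (Fin n)) {g : Param d → ℝ≥0∞} (hg : Measurable g) :
    Measurable fun v => ∫⁻ z, g (applySums c s θ v (batchSum c f D s θ₀ θ B v + z))
        ∂(Measure.pi fun _ : Fin c.P => gaussianReal 0 (Real.toNNReal (c.σ ^ 2 * c.C ^ 2))) := by
  have hu := measurable_update_right (c := c) D hf s θ₀ θ B
  exact (hg.comp hu).lintegral_prod_right'

/-- Given the directions this is the Gaussian mixture bound with M = P(2C)²/(σ²C²). The directions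
have the same law on both sides, so averaging over them costs only Jensen. -/
lemma dualRenyi_batchLaw_mix (hf : ∀ x, Measurable fun θ => f θ x) (hC : 0 < c.C)
    (hP : 1 ≤ c.P) (hσ : 0 < c.σ ^ 2) {q α r : ℝ} (hq0 : 0 ≤ q) (hq1 : q ≤ 1) (hα : 3 ≤ α)
    (hαM : α * (4 * c.P / c.σ ^ 2) ≤ 1 / 4) (hr : α.HolderConjugate r) (s : ℕ) (θ₀ θ : Param d)
    {Da D D' : Fin n → X} {Ba B : Finset (Fin n)}
    (hb : ∀ v p, |batchSum c f D s θ₀ θ B v p - batchSum c f Da s θ₀ θ Ba v p| ≤ 2 * c.C)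
    (hb' : ∀ v p, |batchSum c f D' s θ₀ θ B v p - batchSum c f Da s θ₀ θ Ba v p| ≤ 2 * c.C) :
    DualRenyi (r * r) (ENNReal.ofReal (Real.exp (1152 * (α * q ^ 2 * (4 * c.P / c.σ ^ 2)))))
      (ENNReal.ofReal (1 - q) • batchLaw c f Da s θ₀ θ Ba +
        ENNReal.ofReal q • batchLaw c f D s θ₀ θ B)
      (ENNReal.ofReal (1 - q) • batchLaw c f Da s θ₀ θ Ba +
        ENNReal.ofReal q • batchLaw c f D' s θ₀ θ B) := by
  intro g hg
  have hr1 : 1 < r := hr.symm.lt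
  have hrr : 1 < r * r := by nlinarith
  have hgr : Measurable fun y => g y ^ (r * r) := hg.pow_const _
  have hv0 : 0 < c.σ ^ 2 * c.C ^ 2 := by positivity
  have hv : Real.toNNReal (c.σ ^ 2 * c.C ^ 2) ≠ 0 := by simpa using hv0
  have hP0 : (0 : ℝ) < c.P := by exact_mod_cast hP
  have hM0 : 0 < 4 * c.P / c.σ ^ 2 := by positivity
  have hsq : ∀ x y : Fin c.P → ℝ, (∀ p, |x p - y p| ≤ 2 * c.C) →
      ∑ p, (x p - y p) ^ 2 / (Real.toNNReal (c.σ ^ 2 * c.C ^ 2) : ℝ) ≤ 4 * c.P / c.σ ^ 2 := by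
    intro x y hxy
    rw [Real.coe_toNNReal _ hv0.le]
    calc _ ≤ ∑ _p : Fin c.P, (2 * c.C) ^ 2 / (c.σ ^ 2 * c.C ^ 2) := by
          refine Finset.sum_le_sum fun p _ => ?_
          refine div_le_div_of_nonneg_right ?_ hv0.le
          exact sq_le_sq' (abs_le.1 (hxy p)).1 (abs_le.1 (hxy p)).2
      _ = _ := by
          rw [Finset.sum_const, Finset.card_univ, Fintype.card_fin, nsmul_eq_mul]
          field_simp
          ring
  simp only [lintegral_add_measure, lintegral_smul_measure, smul_eq_mul]
  rw [lintegral_batchLaw hf s θ₀ θ Ba hg, lintegral_batchLaw hf s θ₀ θ B hg,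
    lintegral_batchLaw hf s θ₀ θ Ba hgr, lintegral_batchLaw hf s θ₀ θ B hgr]
  have m1 := measurable_inner_lintegral (c := c) (D := Da) hf s θ₀ θ Ba hg
  have m2 := measurable_inner_lintegral (c := c) (D := D) hf s θ₀ θ B hg
  have m3 := measurable_inner_lintegral (c := c) (D := Da) hf s θ₀ θ Ba hgr
  have m4 := measurable_inner_lintegral (c := c) (D := D') hf s θ₀ θ B hgr
  rw [← lintegral_const_mul _ m1, ← lintegral_const_mul _ m2, ← lintegral_const_mul _ m3,
    ← lintegral_const_mul _ m4, ← lintegral_add_left (m1.const_mul _),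
    ← lintegral_add_left (m3.const_mul _)]
  have hF := ((m3.const_mul (ENNReal.ofReal (1 - q))).add
    (m4.const_mul (ENNReal.ofReal q))).pow_const (1 / (r * r))
  refine (lintegral_mono fun v => lintegral_mix_gaussian_le hv hq0 hq1 hM0 hα hαM hr
    (hsq _ _ (hb v)) (hsq _ _ (hb' v)) (hg.comp (measurable_applySums s θ v))).trans ?_
  refine (lintegral_const_mul _ hF).le.trans ?_
  gcongr
  have := DualRenyi.refl hrr (Measure.pi fun _ : Fin c.P => stdGaussian (Param d)) _ hF
  rw [one_mul] at this
  refine this.trans (le_of_eq ?_)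
  simp only [← ENNReal.rpow_mul, one_div_mul_cancel (show r * r ≠ 0 by positivity),
    ENNReal.rpow_one]
  rfl

lemma dualRenyi_stepLaw (hf : ∀ x, Measurable fun θ => f θ x) (hC : 0 < c.C)
    (hP : 1 ≤ c.P) (hm : 1 ≤ c.m) (hmn : c.m ≤ n) (hσ : 0 < c.σ ^ 2) {α r : ℝ} (hα : 3 ≤ α)
    (hαM : α * (4 * c.P / c.σ ^ 2) ≤ 1 / 4) (hr : α.HolderConjugate r) (s : ℕ) (θ₀ θ : Param d)
    {D D' : Fin n → X} (hD : Adjacent D D') :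
    DualRenyi (r * r) (ENNReal.ofReal
        (Real.exp (1152 * (α * ((c.m : ℝ) / n) ^ 2 * (4 * c.P / c.σ ^ 2)))))
      (stepLaw c f D s θ₀ θ) (stepLaw c f D' s θ₀ θ) := by
  obtain ⟨i₀, hi₀⟩ := hD
  have hr1 : 1 < r := hr.symm.lt
  have hrr : 1 < r * r := by nlinarith
  have hq0 : (0 : ℝ) ≤ (c.m : ℝ) / n := by positivity
  have hq1 : (c.m : ℝ) / n ≤ 1 := div_le_one_of_le₀ (by exact_mod_cast hmn) (by positivity)
  rcases hmn.lt_or_eq with hlt | heq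
  -- The exchanged batch avoids i₀, so it cannot tell the datasets apart: it provides the shared
  -- component.
  · have hcongr : ∀ x ∈ swapPairs c.m i₀,
        batchLaw c f D s θ₀ θ (swapSet i₀ x) = batchLaw c f D' s θ₀ θ (swapSet i₀ x) := by
      intro x hx
      obtain ⟨⟨-, hi⟩, hj⟩ := mem_swapPairs.1 hx
      have hu : ∀ v z, update c f D s θ₀ θ (swapSet i₀ x) v z =
          update c f D' s θ₀ θ (swapSet i₀ x) v z := by
        intro v z
        rw [update_eq_applySums, update_eq_applySums]
        congr 2
        ext p
        refine Finset.sum_congr rfl fun k hk => ?_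
        rw [hi₀ k]
        rintro rfl
        simp only [swapSet, Finset.mem_insert, Finset.mem_erase, ne_eq, not_true_eq_false,
          false_and, or_false] at hk
        exact hj (hk ▸ hi)
      simp only [batchLaw, hu]
    rw [stepLaw_eq, stepLaw_eq, sum_powersetCard_eq_sum_swapPairs hm hlt i₀,
      sum_powersetCard_eq_sum_swapPairs hm hlt i₀]
    refine DualRenyi.sum_smul hrr.le (sum_swapWeight hm hlt i₀) fun x hx => ?_
    rw [← hcongr x hx]
    obtain ⟨⟨-, hi⟩, hj⟩ := mem_swapPairs.1 hx
    have hE : ∀ k ∈ x.1.erase i₀, D k = D' k := fun k hk => hi₀ k (Finset.ne_of_mem_erase hk)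
    exact dualRenyi_batchLaw_mix hf hC hP hσ hq0 hq1 hα hαM hr s θ₀ θ
      (fun v p => abs_batchSum_sub_le hC s θ₀ θ (E := x.1.erase i₀) (by simp) (by simp [hj])
        (Finset.insert_erase hi).symm rfl (fun _ _ => rfl) v p)
      (fun v p => abs_batchSum_sub_le hC s θ₀ θ (E := x.1.erase i₀) (by simp) (by simp [hj])
        (Finset.insert_erase hi).symm rfl (fun k hk => (hE k hk).symm) v p)
  · have hn : (n : ℝ) ≠ 0 := by
      have : 0 < n := by omega
      exact_mod_cast this.ne'
    have hq : (c.m : ℝ) / n = 1 := by rw [heq]; exact div_self hn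
    have hlaw : ∀ D : Fin n → X, stepLaw c f D s θ₀ θ =
        batchLaw c f D s θ₀ θ Finset.univ := by
      intro D
      have : Finset.powersetCard c.m (Finset.univ : Finset (Fin n)) = {Finset.univ} := by
        rw [heq]
        simpa using Finset.powersetCard_self (Finset.univ : Finset (Fin n))
      rw [stepLaw_eq, this, heq]
      simp
    have huniv : (Finset.univ : Finset (Fin n)) = insert i₀ (Finset.univ.erase i₀) :=
      (Finset.insert_erase (Finset.mem_univ _)).symm
    -- For m = n no batch avoids i₀. With q = 1 the shared component has weight zero and is only a
    -- reference for the shifts; the full batch on D' serves.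
    have h := dualRenyi_batchLaw_mix hf hC hP hσ zero_le_one le_rfl hα hαM hr s θ₀ θ
      (Da := D') (D := D) (D' := D') (Ba := Finset.univ) (B := Finset.univ)
      (fun v p => abs_batchSum_sub_le hC s θ₀ θ (E := Finset.univ.erase i₀) (by simp) (by simp)
        huniv huniv (fun k hk => hi₀ k (Finset.ne_of_mem_erase hk)) v p)
      (fun v p => abs_batchSum_sub_le hC s θ₀ θ (E := Finset.univ.erase i₀) (by simp) (by simp)
        huniv huniv (fun _ _ => rfl) v p)
    rw [hlaw, hlaw, hq]
    simpa using h

/-! ### Composition over iterations and stages -/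

lemma dualRenyi_innerLaw (hf : ∀ x, Measurable fun θ => f θ x) {D D' : Fin n → X} {r a : ℝ}
    (hr : 1 < r) (hstep : ∀ s θ₀ θ, DualRenyi r (ENNReal.ofReal (Real.exp a))
      (stepLaw c f D s θ₀ θ) (stepLaw c f D' s θ₀ θ)) (s : ℕ) (θ₀ : Param d) (t : ℕ) :
    DualRenyi r (ENNReal.ofReal (Real.exp (t * a)))
      (innerLaw c f D s θ₀ t) (innerLaw c f D' s θ₀ t) := by
  induction t with
  | zero => simpa [innerLaw] using DualRenyi.refl hr (Measure.dirac θ₀)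
  | succ t ih =>
    have h := ih.bind (by linarith)
      ((measurable_stepLaw (c := c) D hf s).comp measurable_prodMk_left)
      ((measurable_stepLaw (c := c) D' hf s).comp measurable_prodMk_left) (hstep s θ₀)
    rw [← ENNReal.ofReal_mul (Real.exp_pos _).le, ← Real.exp_add] at h
    have e : ((t + 1 : ℕ) : ℝ) * a = t * a + a := by push_cast; ring
    rw [e]
    exact h

lemma dualRenyi_stageLaw (hf : ∀ x, Measurable fun θ => f θ x) (hmn : c.m ≤ n)
    {D D' : Fin n → X} {r a : ℝ} (hr : 1 < r)
    (hstep : ∀ s θ₀ θ, DualRenyi r (ENNReal.ofReal (Real.exp a))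
      (stepLaw c f D s θ₀ θ) (stepLaw c f D' s θ₀ θ)) (θinit : Param d) (s : ℕ) :
    DualRenyi r (ENNReal.ofReal (Real.exp ((∑ i ∈ Finset.Icc 1 s, c.T i : ℕ) * a)))
      (stageLaw c f D θinit s) (stageLaw c f D' θinit s) := by
  induction s with
  | zero => simpa [stageLaw] using DualRenyi.refl hr (Measure.dirac θinit)
  | succ s ih =>
    have h := ih.bind (by linarith) (measurable_innerLaw_and_isProbabilityMeasure D hf hmn (s + 1) (c.T (s + 1))).1
      (measurable_innerLaw_and_isProbabilityMeasure D' hf hmn (s + 1) (c.T (s + 1))).1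
      (fun θ => dualRenyi_innerLaw hf hr hstep (s + 1) θ (c.T (s + 1)))
    rw [← ENNReal.ofReal_mul (Real.exp_pos _).le, ← Real.exp_add] at h
    rw [Finset.sum_Icc_succ_top (by omega), Nat.cast_add, add_mul]
    exact h

/-- The output law satisfies `(ε, δ)`-privacy as soon as some Rényi order `α` does. -/
theorem isDP_of_order (hf : ∀ x, Measurable fun θ => f θ x) (hC : 0 < c.C)
    (hP : 1 ≤ c.P) (hm : 1 ≤ c.m) (hmn : c.m ≤ n) (hσ : 0 < c.σ ^ 2) {α L ε δ : ℝ} (hα : 4 ≤ α)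
    (hαM : α * (4 * c.P / c.σ ^ 2) ≤ 1 / 4) (hε : 0 < ε) (hL : 0 < L) (hδ : 0 < δ)
    (hLδ : -Real.log δ ≤ L)
    (hle : c.totalSteps * (1152 * (α * ((c.m : ℝ) / n) ^ 2 * (4 * c.P / c.σ ^ 2))) + 2 * L / α
      ≤ ε / 2) (θinit : Param d) :
    IsDP (fun D : Fin n → X => stagewiseDPZO c f D θinit) ε δ := by
  intro D D' hD t ht
  have hr : α.HolderConjugate α.conjExponent := Real.HolderConjugate.conjExponent (by linarith)
  set r := α.conjExponent
  have hα0 : 0 < α := by linarith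
  have hr1 : 1 < r := hr.symm.lt
  have hrr : 1 < r * r := by nlinarith
  have hstep := fun s θ₀ θ => dualRenyi_stepLaw (c := c) (f := f) hf hC hP hm hmn hσ
    (by linarith) hαM hr s θ₀ θ hD
  have h := dualRenyi_stageLaw hf hmn hrr hstep θinit c.S
  have i1 := isProbabilityMeasure_stageLaw (c := c) D hf hmn θinit c.S
  have i2 := isProbabilityMeasure_stageLaw (c := c) D' hf hmn θinit c.S
  refine h.measure_le hrr hδ ?_ ht
  have hinv : r⁻¹ = 1 - α⁻¹ := by linarith [hr.inv_add_inv_eq_one]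
  have hrinv : 1 / (r * r) = (1 - α⁻¹) ^ 2 := by
    rw [one_div, mul_inv, hinv, sq]
  rw [div_eq_mul_one_div ε, hrinv]
  change (c.totalSteps : ℝ) * _ - _ ≤ _
  have hb : α⁻¹ ≤ 1 / 4 := by
    rw [inv_le_comm₀ hα0 (by norm_num)]; norm_num; exact hα
  have hb0 : 0 < α⁻¹ := inv_pos.2 hα0
  rw [div_eq_mul_inv (2 * L)] at hle
  generalize α⁻¹ = b at *
  -- With b = 1/α ≤ 1/4, the exponent 1/(r·r) = (1-b)² keeps at least half of ε and charges at most
  -- 2b·L for δ.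
  have h1 : 1 / 2 ≤ (1 - b) ^ 2 := by nlinarith
  have h2 : 0 ≤ 1 - (1 - b) ^ 2 := by nlinarith
  have h3 : 1 - (1 - b) ^ 2 ≤ 2 * b := by nlinarith
  have h4 : -(2 * L * b) ≤ (1 - (1 - b) ^ 2) * Real.log δ := by nlinarith
  nlinarith

end Algorithm

/-- The choice of the Rényi order and of the constants. -/
lemma exists_order {K L ε M W : ℝ} (hK : 0 < K) (hε : 0 < ε) (hL : 0 < L) (hM : 0 ≤ M)
    (hεL : ε ≤ K * L) (hεW : ε < W) (hMW : M * W * L * (1000 * (K + 2)) ^ 2 ≤ 4 * ε ^ 2) :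
    ∃ α : ℝ, 4 ≤ α ∧ α * M ≤ 1 / 4 ∧ 1152 * (α * W * M) + 2 * L / α ≤ ε / 2 := by
  have hαε : (8 * L / ε + 4) * ε = 8 * L + 4 * ε := by field_simp
  have hα4 : 4 ≤ 8 * L / ε + 4 := by
    have : 0 ≤ 8 * L / ε := by positivity
    linarith
  -- 8L/ε makes 2L/α at most ε/4; adding 4 secures α ≥ 4.
  refine ⟨8 * L / ε + 4, hα4, ?_⟩
  generalize 8 * L / ε + 4 = α at *
  have hα0 : 0 < α := by linarith
  have hW : 0 < W := hε.trans hεW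
  -- The only use of ε ≤ KL, and the reason why the constant depends on K.
  have h1 : α * ε ≤ 4 * (K + 2) * L := by linarith
  have h2 : α * W * M * ε * (1000 * (K + 2)) ^ 2 ≤ 16 * (K + 2) * ε ^ 2 := by
    calc α * W * M * ε * (1000 * (K + 2)) ^ 2
        = α * ε * (W * M * (1000 * (K + 2)) ^ 2) := by ring
      _ ≤ 4 * (K + 2) * L * (W * M * (1000 * (K + 2)) ^ 2) := by gcongr
      _ = 4 * (K + 2) * (M * W * L * (1000 * (K + 2)) ^ 2) := by ring
      _ ≤ 4 * (K + 2) * (4 * ε ^ 2) := by gcongr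
      _ = _ := by ring
  have h3 : α * W * M * 125000 ≤ ε := by
    have hpos : 0 < 16 * (K + 2) * ε := by positivity
    refine le_of_mul_le_mul_right ?_ hpos
    have hp : 0 ≤ α * W * M * ε := by positivity
    calc α * W * M * 125000 * (16 * (K + 2) * ε) = α * W * M * ε * (2000000 * (K + 2)) := by ring
      _ ≤ α * W * M * ε * (1000 * (K + 2)) ^ 2 := by
          gcongr
          nlinarith
      _ ≤ 16 * (K + 2) * ε ^ 2 := h2
      _ = ε * (16 * (K + 2) * ε) := by ring
  constructor
  -- Here ε < W turns the bound on the total cost αWM into one on αM.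
  · have h4 : α * M * ε ≤ α * M * W := by gcongr
    have h5 : α * M * 125000 * ε ≤ 1 * ε := by linarith
    have h6 := le_of_mul_le_mul_right h5 hε
    linarith
  · have h7 : 2 * L / α ≤ ε / 4 := by
      rw [div_le_iff₀ hα0]
      linarith
    linarith

end DPZO

theorem mainTheorem1 (K : ℝ) (hK : 0 < K) :
    ∃ c₁ > (0 : ℝ), ∃ c₂ > (0 : ℝ),
      ∀ (X : Type*) (d n : ℕ) (c : DPZO.Config) (f : DPZO.Param d → X → ℝ)
        (θinit : DPZO.Param d) (ε δ : ℝ),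
        (∀ x, Measurable fun θ => f θ x) →
        1 ≤ c.P → 1 ≤ c.m → c.m ≤ n →
        0 < c.C → 0 < c.lam → 0 ≤ c.η₀ → 0 < c.β₀ → 0 < c.k →
        0 < ε → 0 < δ →
        ε ≤ K * Real.log (c.P / δ) →
        ε < c₁ * (c.m : ℝ) ^ 2 * c.totalSteps / (n : ℝ) ^ 2 →
        c₂ ^ 2 * (c.P : ℝ) ^ 2 * (c.m : ℝ) ^ 2 * c.totalSteps * Real.log (c.P / δ)
            / (ε ^ 2 * (n : ℝ) ^ 2) ≤ c.σ ^ 2 →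
        DPZO.IsDP (fun D : Fin n → X => DPZO.stagewiseDPZO c f D θinit) ε δ := by
  refine ⟨1, one_pos, 1000 * (K + 2), by positivity, ?_⟩
  intro X d n c f θinit ε δ hf hP hm hmn hC _ _ _ _ hε hδ hεK hεT hσ
  have hP1 : (1 : ℝ) ≤ c.P := by exact_mod_cast hP
  have hm0 : (0 : ℝ) < c.m := by exact_mod_cast hm
  have hn0 : (0 : ℝ) < n := by exact_mod_cast (by omega : 0 < n)
  set L := Real.log (c.P / δ) with hLdef
  have hL : 0 < L := pos_of_mul_pos_right (hε.trans_le hεK) hK.le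
  have hLδ : -Real.log δ ≤ L := by
    rw [hLdef, Real.log_div (by positivity) hδ.ne']
    linarith [Real.log_nonneg hP1]
  set W : ℝ := (c.totalSteps : ℝ) * ((c.m : ℝ) / n) ^ 2 with hW
  have hεW : ε < W := by
    refine hεT.trans_eq ?_
    rw [hW]
    field_simp
  have hW0 : 0 < W := hε.trans hεW
  have hσ' : (1000 * (K + 2)) ^ 2 * (c.P : ℝ) ^ 2 * W * L ≤ c.σ ^ 2 * ε ^ 2 := by
    have h := mul_le_mul_of_nonneg_right hσ (sq_nonneg ε)
    refine le_of_eq_of_le ?_ h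
    rw [hW]
    field_simp
  have hσ0 : 0 < c.σ ^ 2 := by
    have : 0 < c.σ ^ 2 * ε ^ 2 := lt_of_lt_of_le (by positivity) hσ'
    exact pos_of_mul_pos_left this (sq_nonneg ε)
  have hMW : 4 * c.P / c.σ ^ 2 * W * L * (1000 * (K + 2)) ^ 2 ≤ 4 * ε ^ 2 := by
    have e : 4 * c.P / c.σ ^ 2 * W * L * (1000 * (K + 2)) ^ 2 =
        4 * ((1000 * (K + 2)) ^ 2 * c.P * W * L) / c.σ ^ 2 := by ring
    rw [e, div_le_iff₀ hσ0]
    -- A single factor P in the noise level suffices; the second is given away here.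
    have : (1000 * (K + 2)) ^ 2 * c.P * W * L ≤ (1000 * (K + 2)) ^ 2 * (c.P : ℝ) ^ 2 * W * L := by
      gcongr
      nlinarith
    linarith
  obtain ⟨α, hα, hαM, hle⟩ := DPZO.exists_order hK hε hL (by positivity) hεK hεW hMW
  refine DPZO.isDP_of_order hf hC hP hm hmn hσ0 hα hαM hε hL hδ hLδ ?_ θinit
  have e : (c.totalSteps : ℝ) * (1152 * (α * ((c.m : ℝ) / n) ^ 2 * (4 * c.P / c.σ ^ 2))) =
      1152 * (α * W * (4 * c.P / c.σ ^ 2)) := by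
    rw [hW]; ring
  rw [e]
  exact hle
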